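/- Let $d,K\ge 1$ be integers and let $\frac d2<s\le d$. Write $\mathbb T^d=\mathbb R^d/\mathbb Z^d$. The Sobolev space $W^{s,2}(\mathbb T^d)$ consists of all $w\in L^2(\mathbb T^d)$ with $\sum_{k\in\mathbb Z^d}|k|^{2s}|\widehat w(k)|^2<\infty$. For $2\le q\le\infty$, a matrix function $U\in[L^2(\mathbb T^d)]^{K\times K}$ belongs to the class $\mathfrak M_2^q(K)$ of matrix valued $(2,q)$-multipliers if $A\mapsto \mathcal F_K(U\mathcal F_K^{-1}A)$ is a bounded operator from $[\ell^2(\mathbb Z^d)]^K$ to $[\ell^q(\mathbb Z^d)]^K$, where $\mathcal F_K$ takes Fourier coefficients componentwise. "$W^{-1}\in\mathfrak M_2^q(K)$" means that $W(x)$ is invertible for almost every $x$ and that the function $x\mapsto W(x)^{-1}$ belongs to $\mathfrak M_2^q(K)$. "$\det W$ has a zero" means that $\det W$ has a continuous representative and that this representative vanishes at some point of $\mathbb T^d$. We use the conventions $\frac{d}{d-s}=\infty$ if $s=d$ and $\frac{2d}{d-2}=\infty$ if $d=2$. Let $\mathcal C$ be either of the following two classes of $K\times K$ complex matrix functions on $\mathbb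 T^d$: (a) all $W\in[L^1(\mathbb T^d)]^{K\times K}$ that are Hermitian almost everywhere and whose eigenvalues $\lambda_1(x)\ge\lambda_2(x)\ge\cdots\ge\lambda_K(x)$ satisfy $\lambda_k\in W^{s,2}(\mathbb T^d)$ for every $k=1,\dots,K$; (b) all $W\in[W^{s,2}(\mathbb T^d)]^{K\times K}$ that are Hermitian positive semidefinite almost everywhere. Then the following hold. (i) Suppose $s<\frac d2+1$. If $W\in\mathcal C$ and $\det W$ has a zero, then $W^{-1}\notin\mathfrak M_2^q(K)$ for every $q$ with $2\le q\le\frac{d}{d-s}$. Conversely, for every $q\in(\frac{d}{d-s},\infty]$ there exists $W\in\mathcal C$ such that $\det W$ has a zero and $W^{-1}\in\mathfrak M_2^q(K)$. (ii) Suppose $s=\frac d2+1$. If $W\in\mathcal C$ and $\det W$ has a zero, then $W^{-1}\notin\mathfrak M_2^q(K)$ for every $q$ with $2\le q<\frac{2d}{d-2}$. -/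

import Mathlib

open MeasureTheory
open scoped ENNReal Matrix ComplexOrder

noncomputable section

namespace SobolevMultiplier

/-- The torus `𝕋ᵈ = ℝᵈ / ℤᵈ`. -/
abbrev Torus (d : ℕ) : Type := UnitAddTorus (Fin d)

/-- Normalised Lebesgue measure on `𝕋ᵈ`, i.e. the product of the Haar probability measures on
`ℝ / ℤ`. -/
abbrev torusMeasure (d : ℕ) : Measure (Torus d) :=
  Measure.pi fun _ => AddCircle.haarAddCircle

/-- Mathlib's Fourier coefficient is the integral against the measure above. -/
theorem mFourierCoeff_eq {d : ℕ} (f : Torus d → ℂ) (n : Fin d → ℤ) :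
    UnitAddTorus.mFourierCoeff f n
      = ∫ x, UnitAddTorus.mFourier (-n) x • f x ∂torusMeasure d := rfl

/-- The Sobolev space `W^{s,2}(𝕋ᵈ)`, `s > 0`: square integrable functions `w` with
`∑ₖ |k|^{2s} |ŵ(k)|² < ∞`, where `|k|` is the Euclidean norm, so that
`|k|^{2s} = (∑ᵢ kᵢ²) ^ s`. -/
def MemSobolev {d : ℕ} (s : ℝ) (w : Torus d → ℂ) : Prop :=
  MemLp w 2 (torusMeasure d) ∧
    Summable fun k : Fin d → ℤ =>
      (∑ i, (k i : ℝ) ^ 2) ^ s * ‖UnitAddTorus.mFourierCoeff w k‖ ^ 2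

/-- `f` has a zero: `f` has a continuous representative (necessarily unique), and this
representative vanishes at some point. -/
def HasZero {d : ℕ} (f : Torus d → ℂ) : Prop :=
  ∃ g : Torus d → ℂ, Continuous g ∧ g =ᵐ[torusMeasure d] f ∧ ∃ x, g x = 0

/-- The `k`-th eigenvalue, in decreasing order and with multiplicity, of a Hermitian matrix
(and `0` if the matrix is not Hermitian). -/
def eigenvalueDesc {K : ℕ} (A : Matrix (Fin K) (Fin K) ℂ) (k : Fin K) : ℝ :=
  open Classical in
  if h : A.IsHermitian then h.eigenvalues₀ (Fin.cast (Fintype.card_fin K).symm k) else 0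

/-- The space `ℓ^q(ℤᵈ)` of complex sequences. -/
abbrev SeqSpace (d : ℕ) (q : ℝ≥0∞) : Type := lp (fun _ : Fin d → ℤ => ℂ) q

/-- The space `[ℓ^q(ℤᵈ)]^K`, with the norm `(∑ₖ ‖gₖ‖_q ^ q) ^ (1 / q)` (the maximum of the
`‖gₖ‖_∞` if `q = ∞`). -/
abbrev VecSeqSpace (d K : ℕ) (q : ℝ≥0∞) : Type := PiLp q fun _ : Fin K => SeqSpace d q

/-- The inverse Fourier transform `ℓ²(ℤᵈ) → L²(𝕋ᵈ)`, `a ↦ ∑ₙ a(n) e^{2πi⟨n,x⟩}`. -/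
def invFourier {d : ℕ} (a : SeqSpace d 2) : Torus d → ℂ :=
  ((UnitAddTorus.mFourierBasis (d := Fin d)).repr.symm a :)

/-- The operator `T_U A = 𝓕_K (U 𝓕_K⁻¹ A)`, for `A ∈ [ℓ²(ℤᵈ)]^K`: its `i`-th component, evaluated
at `n ∈ ℤᵈ`. -/
def multiplierOp {d K : ℕ} (U : Torus d → Matrix (Fin K) (Fin K) ℂ) (A : VecSeqSpace d K 2)
    (i : Fin K) (n : Fin d → ℤ) : ℂ :=
  UnitAddTorus.mFourierCoeff (fun x => (U x *ᵥ fun j => invFourier (A j) x) i) n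

/-- The class `𝔐_2^q(K)` of matrix valued `(2,q)`-multipliers: `U ∈ [L²(𝕋ᵈ)]^{K×K}` such that `T_U`
is a bounded operator from `[ℓ²(ℤᵈ)]^K` to `[ℓ^q(ℤᵈ)]^K`. -/
def IsMatrixMultiplier {d K : ℕ} (q : ℝ≥0∞) (U : Torus d → Matrix (Fin K) (Fin K) ℂ) : Prop :=
  (∀ i j, MemLp (fun x => U x i j) 2 (torusMeasure d)) ∧
    ∃ C : ℝ, ∀ A : VecSeqSpace d K 2, ∃ B : VecSeqSpace d K q,
      (∀ i n, B i n = multiplierOp U A i n) ∧ ‖B‖ ≤ C * ‖A‖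

/-- `W⁻¹ ∈ 𝔐_2^q(K)`: the matrices `W x` are invertible for almost every `x`, and their inverses
form a matrix valued `(2,q)`-multiplier. -/
def InverseIsMultiplier {d K : ℕ} (q : ℝ≥0∞) (W : Torus d → Matrix (Fin K) (Fin K) ℂ) : Prop :=
  ∃ U : Torus d → Matrix (Fin K) (Fin K) ℂ,
    (∀ᵐ x ∂torusMeasure d, W x * U x = 1) ∧ IsMatrixMultiplier q U

/-- `W ∈ [L¹(𝕋ᵈ)]^{K×K}` is Hermitian and its ordered eigenvalues `λ₁ ≥ ⋯ ≥ λ_K` all lie in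
`W^{s,2}(𝕋ᵈ)`. -/
def HermitianWithSobolevEigenvalues {d K : ℕ} (s : ℝ)
    (W : Torus d → Matrix (Fin K) (Fin K) ℂ) : Prop :=
  (∀ i j, Integrable (fun x => W x i j) (torusMeasure d)) ∧
    (∀ᵐ x ∂torusMeasure d, (W x).IsHermitian) ∧
    ∀ k, MemSobolev s fun x => (eigenvalueDesc (W x) k : ℂ)

/-- `W` is nonnegative, i.e. Hermitian positive semidefinite almost everywhere, and
`W ∈ [W^{s,2}(𝕋ᵈ)]^{K×K}`. -/
def NonnegWithSobolevEntries {d K : ℕ} (s : ℝ)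
    (W : Torus d → Matrix (Fin K) (Fin K) ℂ) : Prop :=
  (∀ᵐ x ∂torusMeasure d, (W x).PosSemidef) ∧
    ∀ i j, MemSobolev s fun x => W x i j

end SobolevMultiplier

end

open SobolevMultiplier

noncomputable section

namespace SobolevMultiplier

open UnitAddTorus

/-! Non-multipliers. For `d/2 < s < d/2 + 1`, a function in `W^{s,2}` is continuous and varies by
`o(r^{s-d/2})` on the `r`-ball about any point (`MemSobolev.exists_continuousMap`). If `det W`
vanishes at `x₀`, then near `x₀` the matrix `W` is this small along some vector: an eigenvector for
an eigenvalue vanishing at `x₀`, or a fixed kernel vector of the continuous representative at `x₀`.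
So the inverse `U` has size at least `(η r^{s-d/2})⁻¹` on `B_r`, for every `η > 0` and all small
`r`. Dividing by `U` gives `1_{B_r} = ∑ U_ij f_ij` with `|f_ij| ≤ η r^{s-d/2}`, and the multiplier
bound yields `‖𝓕 1_{B_r}‖_q ≲ η r^s`. But `𝓕 1_{B_r}` is at least of order `r^d` on about `r^{-d}`
frequencies, so its norm is `≳ r^{d-d/q}`. If `d - d/q ≤ s`, a small `η` is contradictory
(`IsMatrixMultiplier.false_of_large`). The little `o` is what reaches `q = d/(d-s)`. At `s = d/2 +
1` the argument runs with a slightly smaller exponent, which costs the endpoint.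

Counterexamples. Take `W = w • 1` with `w ∈ W^{s,2}`, `w 0 = 0` and `w ≥ c|x|^α`, where `α` is
slightly above `s - d/2` (`exists_memSobolev_ge_rpow`). Then `1/w ∈ L^p` for `p < d/α`, and `L^p`
functions are `(2,Q)`-multipliers when `1/Q < 1/2 - 1/p` (`isScalarMultiplier_of_memLp`). The
conditions on `α` and `p` are compatible exactly when `Q > d/(d-s)`.

The norms `‖k‖` and `‖x‖` are sup norms throughout. -/

/-! ### Dyadic sums over the lattice. -/

lemma one_le_norm_of_ne_zero {d : ℕ} {k : Fin d → ℤ} (hk : k ≠ 0) : 1 ≤ ‖k‖ := by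
  obtain ⟨i, hi⟩ := Function.ne_iff.mp hk
  refine le_trans ?_ (norm_le_pi_norm k i)
  rw [Int.norm_eq_abs]
  exact_mod_cast Int.one_le_abs hi

/-- A sum over `ℤᵈ` is controlled by its dyadic shells. -/
lemma tsum_le_tsum_dyadic {d : ℕ} (f : (Fin d → ℤ) → ℝ≥0∞) (F : ℤ → ℝ≥0∞) (h0 : f 0 = 0)
    (h : ∀ k ≠ 0, f k ≤ F (Int.log 2 ‖k‖)) :
    ∑' k, f k ≤ ∑' j : ℤ, ENNReal.ofReal ((8 * (2 : ℝ) ^ j) ^ d) * F j := by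
  rw [← ENNReal.tsum_fiberwise f (fun k => Int.log 2 ‖k‖)]
  refine ENNReal.tsum_le_tsum fun j => ?_
  rw [tsum_subtype (f := f)]
  -- The shell of index `j` lies in a cube with `2 * 2^(j+1) + 1 ≤ 8 * 2^j` points per side. Nonzero
  -- lattice points have norm at least `1`, so only `j ≥ 0` matters.
  let B : Finset (Fin d → ℤ) :=
    Fintype.piFinset fun _ => Finset.Icc (-2 ^ (j.toNat + 1)) (2 ^ (j.toNat + 1))
  have key : ∀ k, ((fun k : Fin d → ℤ => Int.log 2 ‖k‖) ⁻¹' {j}).indicator f k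
      ≤ (if 0 ≤ j then (B : Set (Fin d → ℤ)).indicator (fun _ => F j) k else 0) := by
    intro k
    by_cases hk : Int.log 2 ‖k‖ = j
    swap
    · rw [Set.indicator_of_notMem (by simpa using hk)]; exact zero_le
    rw [Set.indicator_of_mem (by simpa using hk)]
    by_cases hk0 : k = 0
    · subst hk0; rw [h0]; exact zero_le
    have h1 := one_le_norm_of_ne_zero hk0
    have hj : 0 ≤ j := by
      rw [← hk, ← Int.zpow_le_iff_le_log Nat.one_lt_two (by linarith)]; simpa using h1
    rw [if_pos hj, Set.indicator_of_mem]
    · exact hk ▸ h k hk0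
    · simp only [B, Finset.mem_coe, Fintype.mem_piFinset, Finset.mem_Icc]
      intro i
      rw [← abs_le]
      have h2 : ‖k‖ < (2 : ℝ) ^ (j + 1) := by
        rw [← hk]; exact_mod_cast Int.lt_zpow_succ_log_self Nat.one_lt_two ‖k‖
      have h3 := (norm_le_pi_norm k i).trans h2.le
      rw [Int.norm_eq_abs] at h3
      lift j to ℕ using hj
      have h4 : ((2 : ℝ) ^ ((j : ℤ) + 1)) = (((2 : ℤ) ^ (j + 1) : ℤ) : ℝ) := by
        push_cast; exact_mod_cast rfl
      rw [h4] at h3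
      simpa using (by exact_mod_cast h3 : |k i| ≤ 2 ^ (j + 1))
  refine (ENNReal.tsum_le_tsum key).trans ?_
  split_ifs with hj
  · have hcard : (B.card : ℝ) ≤ (8 * (2 : ℝ) ^ j) ^ d := by
      simp only [B, Fintype.card_piFinset, Int.card_Icc, Finset.prod_const, Finset.card_univ,
        Fintype.card_fin, Nat.cast_pow]
      refine pow_le_pow_left₀ (by positivity) ?_ d
      lift j to ℕ using hj
      have h1 : (((2 ^ ((j : ℤ).toNat + 1) + 1 - -2 ^ ((j : ℤ).toNat + 1) : ℤ).toNat : ℕ) : ℤ)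
          = 2 ^ (j + 1) + 1 + 2 ^ (j + 1) := by
        rw [Int.toNat_of_nonneg (by simp only [sub_neg_eq_add]; positivity)]; simp
      have h2 := congrArg (Int.cast : ℤ → ℝ) h1
      push_cast at h2
      rw [h2]
      have : (1 : ℝ) ≤ 2 ^ j := one_le_pow₀ (by norm_num)
      rw [zpow_natCast, pow_succ]; linarith
    rw [← tsum_subtype (f := fun _ => F j), Finset.tsum_subtype' B (fun _ => F j),
      Finset.sum_const, nsmul_eq_mul]
    gcongr
    rw [← ENNReal.ofReal_natCast]
    exact ENNReal.ofReal_le_ofReal hcard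
  · simp

/-- Decay as `i → ∞` comes from `β > 0`; as `i → -∞` the factor `2^(2i)` beats `2^(-2βi)` because `β
< 1`. With `β = s - d/2` these are the two bounds on `s`. -/
lemma summable_dyadic_kernel {β : ℝ} (h0 : 0 < β) (h1 : β < 1) :
    Summable fun i : ℤ => (2 : ℝ) ^ (-(2 * β) * i) * min 1 ((2 : ℝ) ^ i) ^ 2 := by
  have hg (c : ℝ) (hc : c < 0) : Summable fun n : ℕ => (2 : ℝ) ^ (c * n) := by
    have : (fun n : ℕ => (2 : ℝ) ^ (c * n)) = fun n : ℕ => ((2 : ℝ) ^ c) ^ n := by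
      ext n; rw [Real.rpow_mul (by norm_num), Real.rpow_natCast]
    rw [this]
    exact summable_geometric_of_lt_one (by positivity)
      (Real.rpow_lt_one_of_one_lt_of_neg (by norm_num) hc)
  apply Summable.of_nat_of_neg
  · refine (hg (-(2 * β)) (by linarith)).congr fun n => ?_
    rw [min_eq_left (by rw [zpow_natCast]; exact one_le_pow₀ (by norm_num))]
    simp
  · refine (hg (2 * β - 2) (by linarith)).congr fun n => ?_
    rw [min_eq_right (zpow_le_one_of_nonpos₀ (by norm_num) (by simp))]
    rw [← Real.rpow_intCast, ← Real.rpow_natCast, ← Real.rpow_mul (by norm_num),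
      ← Real.rpow_add (by norm_num)]
    congr 1; push_cast; ring

/-- The lattice sum behind the `(s - d/2)`-Hölder estimate for `W^{s,2}(𝕋ᵈ)`. -/
lemma exists_tsum_min_le {d : ℕ} {s : ℝ} (hs : (d : ℝ) / 2 < s) (hs1 : s < (d : ℝ) / 2 + 1) :
    ∃ C : ℝ, 0 < C ∧ ∀ m : ℤ,
      ∑' k : Fin d → ℤ, ENNReal.ofReal (‖k‖ ^ (-(2 * s)) * min 1 (‖k‖ * (2 : ℝ) ^ (-m)) ^ 2)
        ≤ ENNReal.ofReal (C * (2 : ℝ) ^ (-(2 * (s - d / 2)) * m)) := by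
  set β := s - d / 2 with hβ
  have hsum := summable_dyadic_kernel (β := β) (by linarith) (by linarith)
  set φ : ℤ → ℝ := fun i => (2 : ℝ) ^ (-(2 * β) * i) * min 1 ((2 : ℝ) ^ i) ^ 2 with hφ
  have hφ0 : ∀ i, 0 ≤ φ i := fun i => by simp only [hφ]; positivity
  have hs0 : 0 < s := lt_of_le_of_lt (by positivity) hs
  refine ⟨8 ^ d * 4 * ∑' i, φ i + 1, ?_, fun m => ?_⟩
  · have : 0 ≤ ∑' i, φ i := tsum_nonneg hφ0
    positivity
  refine (tsum_le_tsum_dyadic _ (fun j => ENNReal.ofReal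
    ((2 : ℝ) ^ (-(2 * s) * j) * (4 * min 1 ((2 : ℝ) ^ (j - m)) ^ 2))) ?_ ?_).trans ?_
  · rw [norm_zero, Real.zero_rpow (by linarith)]; simp
  · intro k hk
    have h1 := one_le_norm_of_ne_zero hk
    set j := Int.log 2 ‖k‖
    have h2 : ‖k‖ < (2 : ℝ) ^ (j + 1) := by
      exact_mod_cast Int.lt_zpow_succ_log_self Nat.one_lt_two ‖k‖
    have h3 : (2 : ℝ) ^ j ≤ ‖k‖ := by
      exact_mod_cast Int.zpow_log_le_self Nat.one_lt_two (by linarith : 0 < ‖k‖)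
    apply ENNReal.ofReal_le_ofReal
    gcongr
    · rw [mul_comm (-(2 * s)) (j : ℝ), Real.rpow_mul (by norm_num), Real.rpow_intCast]
      exact Real.rpow_le_rpow_of_nonpos (by positivity) h3 (by linarith)
    · have h4 : min 1 (‖k‖ * (2 : ℝ) ^ (-m)) ≤ 2 * min 1 ((2 : ℝ) ^ (j - m)) := by
        rw [mul_min_of_nonneg _ _ (by norm_num : (0 : ℝ) ≤ 2)]
        refine min_le_min (by norm_num) ?_
        calc ‖k‖ * (2 : ℝ) ^ (-m) ≤ (2 : ℝ) ^ (j + 1) * (2 : ℝ) ^ (-m) := by gcongr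
          _ = 2 * (2 : ℝ) ^ (j - m) := by
            rw [← zpow_add₀ (by norm_num), ← zpow_one_add₀ (by norm_num)]; congr 1; ring
      calc min 1 (‖k‖ * (2 : ℝ) ^ (-m)) ^ 2 ≤ (2 * min 1 ((2 : ℝ) ^ (j - m))) ^ 2 := by gcongr
        _ = _ := by ring
  -- Since `d - 2s = -2β`, the contribution of shell `j` is `2^(-2βm)` times a function of `j - m`
  -- alone; translating the index then removes `m` from the sum.
  · have hterm : ∀ j : ℤ, ENNReal.ofReal ((8 * (2 : ℝ) ^ j) ^ d) * ENNReal.ofReal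
        ((2 : ℝ) ^ (-(2 * s) * j) * (4 * min 1 ((2 : ℝ) ^ (j - m)) ^ 2))
        = ENNReal.ofReal (8 ^ d * 4 * (2 : ℝ) ^ (-(2 * β) * m) * φ (j - m)) := by
      intro j
      rw [← ENNReal.ofReal_mul (by positivity)]
      congr 1
      have h5 : (2 : ℝ) ^ (-(2 * s) * j) * ((2 : ℝ) ^ j) ^ d
          = (2 : ℝ) ^ (-(2 * β) * m) * (2 : ℝ) ^ (-(2 * β) * ((j - m : ℤ) : ℝ)) := by
        rw [← Real.rpow_intCast, ← Real.rpow_natCast, ← Real.rpow_mul (by norm_num),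
          ← Real.rpow_add (by norm_num), ← Real.rpow_add (by norm_num)]
        congr 1; push_cast; rw [hβ]; ring
      simp only [hφ]
      rw [mul_pow]
      linear_combination (8 ^ d * 4 * min 1 ((2 : ℝ) ^ (j - m)) ^ 2) * h5
    have hshift := (Equiv.subRight m).tsum_eq
      (fun i => ENNReal.ofReal (8 ^ d * 4 * (2 : ℝ) ^ (-(2 * β) * m) * φ i))
    simp only [Equiv.subRight_apply] at hshift
    simp only [hterm]
    rw [hshift, ← ENNReal.ofReal_tsum_of_nonneg (fun i => by have := hφ0 i; positivity) (hsum.mul_left _),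
      tsum_mul_left]
    apply ENNReal.ofReal_le_ofReal
    have : 0 ≤ (2 : ℝ) ^ (-(2 * β) * m) := by positivity
    nlinarith

/-! ### Fourier series and characters on the torus. -/

lemma mFourierCoeff_congr_ae {d : ℕ} {f g : Torus d → ℂ} (h : f =ᵐ[torusMeasure d] g)
    (n : Fin d → ℤ) : mFourierCoeff f n = mFourierCoeff g n := by
  rw [mFourierCoeff_eq, mFourierCoeff_eq]
  refine integral_congr_ae ?_
  filter_upwards [h] with x hx
  rw [hx]

lemma hasSum_sq_norm_mFourierCoeff {d : ℕ} {f : Torus d → ℂ} (hf : MemLp f 2 (torusMeasure d)) :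
    HasSum (fun k => ‖mFourierCoeff f k‖ ^ 2) (∫ x, ‖f x‖ ^ 2 ∂torusMeasure d) := by
  have h := hasSum_sq_mFourierCoeff (hf.toLp f)
  have h1 : ∀ k, mFourierCoeff (hf.toLp f) k = mFourierCoeff f k :=
    mFourierCoeff_congr_ae hf.coeFn_toLp
  simp only [h1] at h
  convert h using 1
  refine integral_congr_ae ?_
  filter_upwards [hf.coeFn_toLp] with x hx
  rw [hx]

lemma ae_eq_of_mFourierCoeff_eq {d : ℕ} {f g : Torus d → ℂ} (hf : MemLp f 2 (torusMeasure d))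
    (hg : MemLp g 2 (torusMeasure d)) (h : ∀ n, mFourierCoeff f n = mFourierCoeff g n) :
    f =ᵐ[torusMeasure d] g := by
  have h1 : hf.toLp f = hg.toLp g := by
    apply (mFourierBasis (d := Fin d)).repr.injective
    ext n
    erw [mFourierBasis_repr, mFourierBasis_repr]
    rw [mFourierCoeff_congr_ae hf.coeFn_toLp, mFourierCoeff_congr_ae hg.coeFn_toLp, h]
  exact (MemLp.toLp_eq_toLp_iff hf hg).mp h1

lemma memLp_invFourier {d : ℕ} (a : SeqSpace d 2) : MemLp (invFourier a) 2 (torusMeasure d) :=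
  Lp.memLp _

lemma mFourierCoeff_invFourier {d : ℕ} (a : SeqSpace d 2) (n : Fin d → ℤ) :
    mFourierCoeff (invFourier a) n = a n := by
  unfold invFourier
  rw [← mFourierBasis_repr, LinearIsometryEquiv.apply_symm_apply]

lemma sq_norm_eq_tsum {d : ℕ} (a : SeqSpace d 2) : ‖a‖ ^ 2 = ∑' n, ‖a n‖ ^ 2 := by
  have := lp.norm_rpow_eq_tsum (p := 2) (by norm_num) a
  simpa using this

lemma integral_sq_norm_invFourier {d : ℕ} (a : SeqSpace d 2) :
    ∫ x, ‖invFourier a x‖ ^ 2 ∂torusMeasure d = ‖a‖ ^ 2 := by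
  rw [← (hasSum_sq_norm_mFourierCoeff (memLp_invFourier a)).tsum_eq, sq_norm_eq_tsum]
  simp only [mFourierCoeff_invFourier]

lemma exists_invFourier_ae_eq {d : ℕ} {f : Torus d → ℂ} (hf : MemLp f 2 (torusMeasure d)) :
    ∃ a : SeqSpace d 2, invFourier a =ᵐ[torusMeasure d] f := by
  refine ⟨(mFourierBasis (d := Fin d)).repr (hf.toLp f), ?_⟩
  unfold invFourier
  rw [LinearIsometryEquiv.symm_apply_apply]
  exact hf.coeFn_toLp

lemma norm_mFourier_apply {d : ℕ} (n : Fin d → ℤ) (x : Torus d) : ‖mFourier n x‖ = 1 := by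
  simp only [mFourier, ContinuousMap.coe_mk, norm_prod, fourier_apply, Circle.norm_coe,
    Finset.prod_const_one]

lemma integrable_mFourier_smul {d : ℕ} {f : Torus d → ℂ} (hf : Integrable f (torusMeasure d))
    (n : Fin d → ℤ) : Integrable (fun x => mFourier (-n) x • f x) (torusMeasure d) := by
  refine hf.bdd_mul (c := 1) (by fun_prop) (ae_of_all _ fun x => ?_)
  simp [norm_mFourier_apply]

lemma norm_mFourierCoeff_le {d : ℕ} (f : Torus d → ℂ) (n : Fin d → ℤ) :
    ‖mFourierCoeff f n‖ ≤ ∫ x, ‖f x‖ ∂torusMeasure d := by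
  rw [mFourierCoeff_eq]
  refine (norm_integral_le_integral_norm _).trans (le_of_eq ?_)
  simp [norm_mFourier_apply]

lemma memLp_continuousMap {d : ℕ} (F : C(Torus d, ℂ)) (p : ℝ≥0∞) :
    MemLp F p (torusMeasure d) :=
  MemLp.of_bound (by fun_prop) ‖F‖ (ae_of_all _ F.norm_coe_le_norm)

/-- An absolutely convergent Fourier series. -/
lemma exists_continuousMap_of_summable {d : ℕ} {c : (Fin d → ℤ) → ℂ}
    (hc : Summable fun k => ‖c k‖) :
    ∃ F : C(Torus d, ℂ), (∀ x, HasSum (fun k => c k * mFourier k x) (F x)) ∧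
      ∀ n, mFourierCoeff F n = c n := by
  have hs : Summable fun k => c k • (mFourier k : C(Torus d, ℂ)) := by
    refine .of_norm ?_
    simpa only [norm_smul, mFourier_norm, mul_one] using hc
  refine ⟨∑' k, c k • mFourier k, fun x => ?_, fun n => ?_⟩
  · simpa only [map_smul] using! (ContinuousMap.evalCLM ℂ x).hasSum hs.hasSum
  · have h1 := mFourierCoeff_toLp (∑' k, c k • (mFourier k : C(Torus d, ℂ))) n
    rw [← h1, ← mFourierBasis_repr, HilbertBasis.repr_apply_apply]
    have h2 := (innerSL ℂ (mFourierBasis (d := Fin d) n)).hasSum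
      ((ContinuousMap.toLp (E := ℂ) 2 (torusMeasure d) ℂ).hasSum hs.hasSum)
    have h3 : ∀ k, innerSL ℂ (mFourierBasis (d := Fin d) n)
        (ContinuousMap.toLp (E := ℂ) 2 (torusMeasure d) ℂ (c k • mFourier k))
        = if n = k then c k else 0 := by
      intro k
      simp only [map_smul, coe_mFourierBasis, innerSL_apply_apply]
      have := orthonormal_iff_ite.mp (orthonormal_mFourier (d := Fin d)) n k
      erw [this]
      simp
    have h4 := hasSum_single (f := fun k => innerSL ℂ (mFourierBasis (d := Fin d) n)
      (ContinuousMap.toLp (E := ℂ) 2 (torusMeasure d) ℂ (c k • mFourier k))) n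
      (fun k hk => by rw [h3, if_neg hk.symm])
    have h5 := h2.unique h4
    rw [h3, if_pos rfl] at h5
    exact h5

/-- The lift nearest to `0`, on which the quotient norm is the absolute value; it reduces estimates
of characters to real exponentials. -/
lemma exists_real_lift (z : UnitAddCircle) : ∃ t : ℝ, (t : UnitAddCircle) = z ∧ |t| = ‖z‖ := by
  induction z using QuotientAddGroup.induction_on with
  | H x =>
    refine ⟨x - round x, ?_, ?_⟩
    · have : ((round x : ℝ) : UnitAddCircle) = 0 := by
        rw [AddCircle.coe_eq_zero_iff]
        exact ⟨round x, by simp⟩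
      rw [AddCircle.coe_sub, this, sub_zero]
    · exact (UnitAddCircle.norm_eq (x := x)).symm

lemma mFourier_sub {d : ℕ} (n : Fin d → ℤ) (x y : Torus d) :
    mFourier n (x - y) * mFourier n y = mFourier n x := by
  simp only [mFourier, ContinuousMap.coe_mk, ← Finset.prod_mul_distrib]
  refine Finset.prod_congr rfl fun i _ => ?_
  simp only [fourier_apply, Pi.sub_apply, sub_eq_add_neg, ← Circle.coe_mul,
    ← AddCircle.toCircle_add]
  simp

lemma norm_mFourier_sub_one_le {d : ℕ} (n : Fin d → ℤ) (x : Torus d) :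
    ‖mFourier n x - 1‖ ≤ 2 * Real.pi * d * ‖n‖ * ‖x‖ := by
  choose t ht ht' using fun i => exists_real_lift (x i)
  have h1 : mFourier n x = Complex.exp (Complex.I * ((2 * Real.pi * ∑ i, n i * t i : ℝ) : ℂ)) := by
    simp only [mFourier, ContinuousMap.coe_mk]
    push_cast
    rw [Finset.mul_sum, Finset.mul_sum, Complex.exp_sum]
    refine Finset.prod_congr rfl fun i _ => ?_
    rw [← ht i, fourier_coe_apply]
    congr 1
    push_cast; ring
  rw [h1]
  refine (Real.norm_exp_I_mul_ofReal_sub_one_le).trans ?_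
  rw [norm_mul, Real.norm_of_nonneg (by positivity)]
  have h2 : ‖∑ i, (n i : ℝ) * t i‖ ≤ d * (‖n‖ * ‖x‖) := by
    refine (norm_sum_le _ _).trans ?_
    refine (Finset.sum_le_card_nsmul _ _ (‖n‖ * ‖x‖) fun i _ => ?_).trans (by simp)
    rw [norm_mul, Real.norm_eq_abs (t i), ht']
    gcongr
    · rw [Int.norm_cast_real]; exact norm_le_pi_norm n i
    · exact norm_le_pi_norm x i
  calc _ ≤ 2 * Real.pi * (d * (‖n‖ * ‖x‖)) := by gcongr
    _ = _ := by ring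

lemma norm_mFourier_sub_le {d : ℕ} (n : Fin d → ℤ) (x y : Torus d) :
    ‖mFourier n x - mFourier n y‖ ≤ 2 * Real.pi * d * ‖n‖ * ‖x - y‖ := by
  rw [← mFourier_sub n x y]
  calc ‖mFourier n (x - y) * mFourier n y - mFourier n y‖
      = ‖mFourier n (x - y) - 1‖ * ‖mFourier n y‖ := by rw [← norm_mul]; congr 1; ring
    _ ≤ _ := by rw [norm_mFourier_apply, mul_one]; exact norm_mFourier_sub_one_le n _

lemma norm_mFourier_sub_le_two {d : ℕ} (n : Fin d → ℤ) (x y : Torus d) :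
    ‖mFourier n x - mFourier n y‖ ≤ 2 := by
  refine (norm_sub_le _ _).trans ?_
  rw [norm_mFourier_apply, norm_mFourier_apply]; norm_num

lemma haarAddCircle_eq_volume : (AddCircle.haarAddCircle : Measure UnitAddCircle) = volume := by
  rw [AddCircle.volume_eq_smul_haarAddCircle]; simp

lemma torusMeasure_closedBall {d : ℕ} (x : Torus d) {r : ℝ} (h0 : 0 ≤ r) (h1 : r ≤ 1 / 2) :
    torusMeasure d (Metric.closedBall x r) = ENNReal.ofReal ((2 * r) ^ d) := by
  rw [closedBall_pi _ h0, torusMeasure, Measure.pi_pi]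
  simp only [haarAddCircle_eq_volume, AddCircle.volume_closedBall]
  rw [min_eq_right (by linarith)]
  simp [ENNReal.ofReal_pow (by linarith : 0 ≤ 2 * r)]

/-! ### Sobolev functions and their modulus of continuity. -/

lemma summable_mul_and_tsum_mul_le {ι : Type*} {f g : ι → ℝ} (hf : ∀ i, 0 ≤ f i) (hg : ∀ i, 0 ≤ g i)
    (hf2 : Summable fun i => f i ^ 2) (hg2 : Summable fun i => g i ^ 2) :
    (Summable fun i => f i * g i) ∧
      ∑' i, f i * g i ≤ √(∑' i, f i ^ 2) * √(∑' i, g i ^ 2) := by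
  have h := Real.summable_and_inner_le_Lp_mul_Lq_tsum_of_nonneg Real.HolderConjugate.two_two hf hg
    (by simpa using hf2) (by simpa using hg2)
  simpa [Real.sqrt_eq_rpow] using h

lemma sq_norm_le_sum_sq {d : ℕ} (k : Fin d → ℤ) : ‖k‖ ^ 2 ≤ ∑ i, (k i : ℝ) ^ 2 := by
  have h0 : 0 ≤ ∑ i, (k i : ℝ) ^ 2 := by positivity
  rw [← Real.le_sqrt (norm_nonneg _) h0, pi_norm_le_iff_of_nonneg (Real.sqrt_nonneg _)]
  intro i
  apply Real.le_sqrt_of_sq_le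
  rw [Int.norm_eq_abs, sq_abs]
  exact Finset.single_le_sum (f := fun i => (k i : ℝ) ^ 2) (fun _ _ => by positivity)
    (Finset.mem_univ i)

lemma sum_sq_le_mul_sq_norm {d : ℕ} (k : Fin d → ℤ) : ∑ i, (k i : ℝ) ^ 2 ≤ d * ‖k‖ ^ 2 := by
  refine (Finset.sum_le_card_nsmul _ _ (‖k‖ ^ 2) fun i _ => ?_).trans (by simp)
  rw [← sq_abs, ← Int.norm_eq_abs]
  gcongr
  exact norm_le_pi_norm k i

lemma MemSobolev.mono {d : ℕ} {s t : ℝ} {w : Torus d → ℂ} (ht : 0 < t) (hts : t ≤ s)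
    (hw : MemSobolev s w) : MemSobolev t w := by
  refine ⟨hw.1, hw.2.of_nonneg_of_le (fun k => by positivity) fun k => ?_⟩
  gcongr ?_ * _
  by_cases hk : k = 0
  · subst hk
    simp [Real.zero_rpow ht.ne', Real.zero_rpow (ht.trans_le hts).ne']
  · refine Real.rpow_le_rpow_of_exponent_le ?_ hts
    have := one_le_norm_of_ne_zero hk
    nlinarith [sq_norm_le_sum_sq k]

/-- Functions in `W^{s,2}(𝕋ᵈ)`, `d/2 < s < d/2 + 1`, have a continuous representative, with
modulus of continuity `o(r^{s - d/2})` at every point. -/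
theorem MemSobolev.exists_continuousMap {d : ℕ} {s : ℝ} {w : Torus d → ℂ} (hs : (d : ℝ) / 2 < s)
    (hs1 : s < (d : ℝ) / 2 + 1) (hw : MemSobolev s w) :
    ∃ F : C(Torus d, ℂ), F =ᵐ[torusMeasure d] w ∧
      ∀ x₀, ∀ η > 0, ∀ᶠ r in nhdsWithin 0 (Set.Ioi 0), ∀ x, ‖x - x₀‖ ≤ r →
        ‖F x - F x₀‖ ≤ η * r ^ (s - d / 2) := by
  have hs0 : 0 < s := lt_of_le_of_lt (by positivity) hs
  obtain ⟨C, hC, hCb⟩ := exists_tsum_min_le hs hs1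
  set β := s - d / 2 with hβ
  set c := fun k => mFourierCoeff w k with hc
  -- Cauchy–Schwarz set-up: for `|x - x₀| ≤ 2^(-m)` the `k`-th character varies by a multiple of
  -- `min 1 (‖k‖ 2^(-m))`. The product of this with `|c k|` splits into `κ m k`, of `ℓ²` norm `≲
  -- 2^(-βm)`, and the Sobolev weight `W k`.
  let κ : ℤ → (Fin d → ℤ) → ℝ := fun m k => ‖k‖ ^ (-s) * min 1 (‖k‖ * (2 : ℝ) ^ (-m))
  have hκ0 : ∀ m k, 0 ≤ κ m k := fun m k => by simp only [κ]; positivity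
  have hκsq : ∀ m k, κ m k ^ 2 = ‖k‖ ^ (-(2 * s)) * min 1 (‖k‖ * (2 : ℝ) ^ (-m)) ^ 2 := by
    intro m k
    simp only [κ]
    rw [mul_pow, ← Real.rpow_mul_natCast (norm_nonneg k)]
    congr 2; push_cast; ring
  have hκsum : ∀ m, (Summable fun k => κ m k ^ 2) ∧ √(∑' k, κ m k ^ 2) ≤ √C * (2 : ℝ) ^ (-β * m) := by
    intro m
    have h1 := hCb m
    simp only [← hκsq] at h1
    have h2 : Summable fun k => κ m k ^ 2 := by
      have h3 := ENNReal.summable_toReal (ne_top_of_le_ne_top ENNReal.ofReal_ne_top h1)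
      refine h3.congr fun k => ?_
      rw [ENNReal.toReal_ofReal (by positivity)]
    refine ⟨h2, ?_⟩
    rw [← ENNReal.ofReal_tsum_of_nonneg (fun k => by positivity) h2,
      ENNReal.ofReal_le_ofReal_iff (by positivity)] at h1
    refine (Real.sqrt_le_sqrt h1).trans (le_of_eq ?_)
    rw [Real.sqrt_mul hC.le, Real.sqrt_eq_rpow ((2 : ℝ) ^ _), ← Real.rpow_mul (by norm_num)]
    congr 2; ring
  let W : (Fin d → ℤ) → ℝ := fun k => ‖k‖ ^ s * ‖c k‖
  have hW0 : ∀ k, 0 ≤ W k := fun k => by positivity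
  have hWsum : Summable fun k => W k ^ 2 := by
    refine hw.2.of_nonneg_of_le (fun k => by positivity) fun k => ?_
    simp only [W, hc]
    rw [mul_pow]
    gcongr
    rw [← Real.rpow_mul_natCast (norm_nonneg k), mul_comm, Real.rpow_mul (norm_nonneg k)]
    refine Real.rpow_le_rpow (by positivity) ?_ hs0.le
    rw [Real.rpow_natCast]
    exact sq_norm_le_sum_sq k
  have hκW : ∀ m k, k ≠ 0 → min 1 (‖k‖ * (2 : ℝ) ^ (-m)) * ‖c k‖ = κ m k * W k := by
    intro m k hk
    have := one_le_norm_of_ne_zero hk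
    simp only [κ, W]
    rw [Real.rpow_neg (norm_nonneg k)]
    have : ‖k‖ ^ s ≠ 0 := by positivity
    field_simp
  have hcsum : Summable fun k => ‖c k‖ := by
    have h1 := (summable_mul_and_tsum_mul_le (hκ0 0) hW0 (hκsum 0).1 hWsum).1
    refine (summable_congr_cofinite ?_).mp h1
    filter_upwards [(Set.finite_singleton (0 : Fin d → ℤ)).compl_mem_cofinite] with k hk
    rw [← hκW 0 k hk, min_eq_left (by simpa using one_le_norm_of_ne_zero hk), one_mul]
  obtain ⟨F, hF, hFc⟩ := exists_continuousMap_of_summable hcsum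
  refine ⟨F, ae_eq_of_mFourierCoeff_eq (memLp_continuousMap F 2) hw.1 hFc, fun x₀ η hη => ?_⟩
  set A : ℝ := 2 + 2 * Real.pi * d with hA
  have hA0 : 0 < A := by positivity
  set ε : ℝ := η / 2 / (A * (√C * 2 ^ β)) with hε
  have hε0 : 0 < ε := by positivity
  -- This split upgrades `O(r^β)` to `o(r^β)`: off the finite set `T` the Sobolev norm is at most
  -- `ε`, while the characters in `T` are Lipschitz and `L * r = o(r^β)` because `β < 1`. Each part
  -- receives `η / 2`.
  obtain ⟨T, hT⟩ : ∃ T : Finset (Fin d → ℤ),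
      ∑' k, ((T : Set (Fin d → ℤ))ᶜ.indicator W k) ^ 2 ≤ ε ^ 2 := by
    have h1 := tendsto_tsum_compl_atTop_zero fun k => W k ^ 2
    obtain ⟨T, hT⟩ := (h1.eventually (gt_mem_nhds (by positivity : 0 < ε ^ 2))).exists
    refine ⟨T, ?_⟩
    refine le_trans (le_of_eq ?_) hT.le
    refine Eq.trans ?_ (tsum_subtype (T : Set (Fin d → ℤ))ᶜ fun k => W k ^ 2).symm
    refine tsum_congr fun k => ?_
    by_cases hk : k ∈ T <;> simp [hk]
  set W' := (T : Set (Fin d → ℤ))ᶜ.indicator W with hW'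
  have hW'0 : ∀ k, 0 ≤ W' k := fun k => Set.indicator_nonneg (fun k _ => hW0 k) k
  have hW'sum : Summable fun k => W' k ^ 2 := by
    refine hWsum.of_nonneg_of_le (fun k => by positivity) fun k => ?_
    gcongr
    · exact hW'0 k
    · exact Set.indicator_le_self' (fun k _ => hW0 k) k
  set L : ℝ := ∑ k ∈ T, ‖c k‖ * (2 * Real.pi * d * ‖k‖) with hL
  have hL0 : 0 ≤ L := Finset.sum_nonneg fun k _ => by positivity
  have hβ1 : 0 < 1 - β := by linarith
  filter_upwards [Ioc_mem_nhdsGT (by positivity : 0 < (η / 2 / (L + 1)) ^ (1 / (1 - β)))]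
    with r ⟨hr, hrr⟩ x hx
  have hLr : L * r ≤ η / 2 * r ^ β := by
    have h1 : r ^ (1 - β) ≤ η / 2 / (L + 1) := by
      refine (Real.rpow_le_rpow hr.le hrr hβ1.le).trans (le_of_eq ?_)
      rw [← Real.rpow_mul (by positivity), one_div_mul_cancel hβ1.ne', Real.rpow_one]
    have h2 : r = r ^ (1 - β) * r ^ β := by
      rw [← Real.rpow_add hr]; simp
    rw [le_div_iff₀ (by positivity)] at h1
    have h3 : 0 ≤ r ^ (1 - β) := by positivity
    have h4 : 0 ≤ r ^ β := by positivity
    calc L * r = (L * r ^ (1 - β)) * r ^ β := by rw [mul_assoc, ← h2]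
      _ ≤ η / 2 * r ^ β := by gcongr; linarith
  set j := Int.log 2 r with hj
  have hj1 : (2 : ℝ) ^ j ≤ r := by exact_mod_cast Int.zpow_log_le_self Nat.one_lt_two hr
  have hj2 : r < (2 : ℝ) ^ (j + 1) := by
    exact_mod_cast Int.lt_zpow_succ_log_self Nat.one_lt_two r
  -- With this choice `r < 2^(-m) ≤ 2r`, which accounts for the factor `2^β` in `ε`.
  set m : ℤ := -(j + 1) with hm
  have hm1 : r ≤ (2 : ℝ) ^ (-m) := by rw [hm, neg_neg]; exact hj2.le
  have hm2 : (2 : ℝ) ^ (-β * m) ≤ 2 ^ β * r ^ β := by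
    have : (2 : ℝ) ^ (-β * m) = ((2 : ℝ) ^ (j + 1)) ^ β := by
      rw [← Real.rpow_intCast, ← Real.rpow_mul (by norm_num), hm]
      congr 1; push_cast; ring
    rw [this, ← Real.mul_rpow (by norm_num) hr.le]
    refine Real.rpow_le_rpow (by positivity) ?_ (by linarith)
    rw [zpow_add_one₀ (by norm_num)]; linarith
  obtain ⟨hs1, hs2⟩ := summable_mul_and_tsum_mul_le (hκ0 m) hW'0 (hκsum m).1 hW'sum
  have hdiff : HasSum (fun k => c k * (mFourier k x - mFourier k x₀)) (F x - F x₀) := by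
    simpa only [mul_sub] using (hF x).sub (hF x₀)
  have hbound : ∀ k, ‖c k * (mFourier k x - mFourier k x₀)‖ ≤
      (T : Set (Fin d → ℤ)).indicator (fun k => ‖c k‖ * (2 * Real.pi * d * ‖k‖) * r) k
        + A * (κ m k * W' k) := by
    intro k
    rw [norm_mul]
    have h1 : ‖mFourier k x - mFourier k x₀‖ ≤ 2 * Real.pi * d * ‖k‖ * r :=
      (norm_mFourier_sub_le k x x₀).trans (by gcongr)
    by_cases hk : k ∈ T
    · rw [Set.indicator_of_mem (by simpa using hk)]
      have : 0 ≤ A * (κ m k * W' k) := mul_nonneg hA0.le (mul_nonneg (hκ0 m k) (hW'0 k))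
      calc _ ≤ ‖c k‖ * (2 * Real.pi * d * ‖k‖ * r) := by gcongr
        _ ≤ _ := by linarith
    · rw [Set.indicator_of_notMem (by simpa using hk), zero_add, hW',
        Set.indicator_of_mem (by simpa using hk)]
      by_cases hk0 : k = 0
      · subst hk0
        simp only [mFourier_zero, ContinuousMap.one_apply, sub_self, norm_zero, mul_zero]
        exact mul_nonneg hA0.le (mul_nonneg (hκ0 m 0) (hW0 0))
      rw [← hκW m k hk0]
      calc ‖c k‖ * ‖mFourier k x - mFourier k x₀‖ ≤ ‖c k‖ * (A * min 1 (‖k‖ * 2 ^ (-m))) := by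
            gcongr
            rw [mul_min_of_nonneg _ _ hA0.le]
            refine le_min ?_ ?_
            · refine (norm_mFourier_sub_le_two k x x₀).trans ?_
              rw [hA, mul_one]
              have : 0 ≤ 2 * Real.pi * d := by positivity
              linarith
            · calc _ ≤ 2 * Real.pi * d * ‖k‖ * r := h1
                _ ≤ A * ‖k‖ * 2 ^ (-m) := by gcongr; linarith
                _ = _ := by ring
        _ = _ := by ring
  have hsumb : HasSum (fun k => (T : Set (Fin d → ℤ)).indicator
      (fun k => ‖c k‖ * (2 * Real.pi * d * ‖k‖) * r) k + A * (κ m k * W' k))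
      (L * r + A * ∑' k, κ m k * W' k) := by
    refine HasSum.add ?_ (hs1.hasSum.mul_left A)
    rw [hL, Finset.sum_mul]
    exact hasSum_subtype_iff_indicator.mp (Finset.hasSum T _)
  have hfin := tsum_of_norm_bounded hsumb hbound
  rw [hdiff.tsum_eq] at hfin
  refine hfin.trans ?_
  have h6 : ∑' k, κ m k * W' k ≤ (√C * (2 ^ β * r ^ β)) * ε := by
    refine hs2.trans ?_
    gcongr
    · exact (hκsum m).2.trans (by gcongr)
    · exact (Real.sqrt_le_sqrt hT).trans (by rw [Real.sqrt_sq hε0.le])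
  have h7 : A * ((√C * (2 ^ β * r ^ β)) * ε) = η / 2 * r ^ β := by
    rw [hε]
    field_simp
  have h8 := mul_le_mul_of_nonneg_left h6 hA0.le
  linarith

/-! ### Testing a multiplier on indicator functions of small balls. -/

/-- The entries of a matrix valued multiplier are scalar multipliers. -/
lemma IsMatrixMultiplier.exists_entry {d K : ℕ} {q : ℝ≥0∞} (hq : 1 ≤ q)
    {U : Torus d → Matrix (Fin K) (Fin K) ℂ} (hU : IsMatrixMultiplier q U) :
    ∃ C : ℝ, 0 ≤ C ∧ ∀ i j, ∀ f : Torus d → ℂ, MemLp f 2 (torusMeasure d) →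
      ∃ b : SeqSpace d q, (∀ n, b n = mFourierCoeff (fun x => U x i j * f x) n) ∧
        ‖b‖ ≤ C * √(∫ x, ‖f x‖ ^ 2 ∂torusMeasure d) := by
  have : Fact (1 ≤ q) := ⟨hq⟩
  obtain ⟨-, C, hC⟩ := hU
  refine ⟨|C|, abs_nonneg C, fun i j f hf => ?_⟩
  obtain ⟨a, ha⟩ := exists_invFourier_ae_eq hf
  obtain ⟨B, hB, hBn⟩ := hC (PiLp.single 2 j a)
  refine ⟨B i, fun n => ?_, ?_⟩
  · rw [hB, multiplierOp]
    refine mFourierCoeff_congr_ae ?_ n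
    have h0 : invFourier (0 : SeqSpace d 2) =ᵐ[torusMeasure d] 0 := by
      unfold invFourier
      rw [map_zero]
      exact Lp.coeFn_zero _ _ _
    filter_upwards [ha, h0] with x hx hx0
    rw [Matrix.mulVec, dotProduct, Finset.sum_eq_single j]
    · rw [PiLp.single_eq_same, hx]
    · intro l _ hl
      rw [PiLp.single_eq_of_ne 2 hl, hx0]; simp
    · simp
  · have h1 : ‖a‖ = √(∫ x, ‖f x‖ ^ 2 ∂torusMeasure d) := by
      rw [eq_comm, Real.sqrt_eq_iff_eq_sq (by positivity) (norm_nonneg a),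
        ← integral_sq_norm_invFourier]
      refine integral_congr_ae ?_
      filter_upwards [ha] with x hx
      rw [hx]
    rw [PiLp.norm_single, h1] at hBn
    exact ((PiLp.norm_apply_le B i).trans hBn).trans (by gcongr; exact le_abs_self C)

/-- The sum of squares of the entries. -/
def entrySq {K : ℕ} (A : Matrix (Fin K) (Fin K) ℂ) : ℝ := ∑ i, ∑ j, ‖A i j‖ ^ 2

lemma sum_sq_norm_mulVec_le {K : ℕ} (A : Matrix (Fin K) (Fin K) ℂ) (v : Fin K → ℂ) :
    ∑ i, ‖(A *ᵥ v) i‖ ^ 2 ≤ entrySq A * ∑ j, ‖v j‖ ^ 2 := by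
  rw [entrySq, Finset.sum_mul]
  refine Finset.sum_le_sum fun i _ => ?_
  rw [Matrix.mulVec, dotProduct]
  calc ‖∑ j, A i j * v j‖ ^ 2 ≤ (∑ j, ‖A i j‖ * ‖v j‖) ^ 2 := by
        gcongr
        exact (norm_sum_le _ _).trans (by simp)
    _ ≤ _ := Finset.sum_mul_sq_le_sq_mul_sq _ _ _

lemma entrySq_nonneg {K : ℕ} (A : Matrix (Fin K) (Fin K) ℂ) : 0 ≤ entrySq A := by
  unfold entrySq; positivity

lemma sq_norm_le_entrySq {K : ℕ} (A : Matrix (Fin K) (Fin K) ℂ) (i j : Fin K) :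
    ‖A i j‖ ^ 2 ≤ entrySq A :=
  (Finset.single_le_sum (f := fun j => ‖A i j‖ ^ 2) (fun _ _ => by positivity)
    (Finset.mem_univ j)).trans
    (Finset.single_le_sum (f := fun i => ∑ j, ‖A i j‖ ^ 2) (fun _ _ => by positivity)
      (Finset.mem_univ i))

/-- If `U` is a multiplier that is large on a ball, then the Fourier coefficients of the indicator
function of that ball are small in `ℓ^q`. -/
lemma IsMatrixMultiplier.exists_indicator_bound {d K : ℕ} {q : ℝ≥0∞} (hq : 1 ≤ q)
    {U : Torus d → Matrix (Fin K) (Fin K) ℂ} (hU : IsMatrixMultiplier q U) :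
    ∃ C : ℝ, 0 ≤ C ∧ ∀ (S : Set (Torus d)) (M : ℝ), MeasurableSet S → 0 ≤ M →
      (∀ᵐ x ∂torusMeasure d, x ∈ S → 1 ≤ M ^ 2 * entrySq (U x)) →
      ∃ b : SeqSpace d q, (∀ n, b n = mFourierCoeff (S.indicator fun _ => 1) n) ∧
        ‖b‖ ≤ C * (M * √((torusMeasure d).real S)) := by
  have : Fact (1 ≤ q) := ⟨hq⟩
  obtain ⟨C, hC0, hC⟩ := hU.exists_entry hq
  refine ⟨K * K * C, by positivity, fun S M hS hM h => ?_⟩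
  have hUm := hU.1
  have hv : AEStronglyMeasurable (fun x => entrySq (U x)) (torusMeasure d) := by
    unfold entrySq
    refine Finset.aestronglyMeasurable_fun_sum _ fun i _ =>
      Finset.aestronglyMeasurable_fun_sum _ fun j _ => ?_
    exact (hUm i j).1.norm.pow 2
  -- The conjugate solution `f = Ū / |U|²` of `∑ U_ij f_ij = 1` on `S`; it satisfies `|f_ij| ≤ 1 /
  -- |U| ≤ M` there.
  let f : Fin K → Fin K → Torus d → ℂ := fun i j =>
    S.indicator fun x => star (U x i j) * ((entrySq (U x))⁻¹ : ℝ)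
  have hfm : ∀ i j, AEStronglyMeasurable (f i j) (torusMeasure d) := by
    intro i j
    refine AEStronglyMeasurable.indicator ?_ hS
    exact ((hUm i j).1.star).mul (Complex.continuous_ofReal.comp_aestronglyMeasurable
      hv.aemeasurable.inv.aestronglyMeasurable)
  have hfb : ∀ i j, ∀ᵐ x ∂torusMeasure d, ‖f i j x‖ ^ 2 ≤ S.indicator (fun _ => M ^ 2) x := by
    intro i j
    filter_upwards [h] with x hx
    by_cases hxS : x ∈ S
    · have h1 := hx hxS
      simp only [f, Set.indicator_of_mem hxS]
      have hpos : 0 < entrySq (U x) := by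
        rcases (entrySq_nonneg (U x)).eq_or_lt with h0 | h0
        · rw [← h0] at h1; norm_num at h1
        · exact h0
      rw [norm_mul, norm_star, Complex.norm_real, Real.norm_of_nonneg (by positivity), mul_pow,
        inv_pow, ← div_eq_mul_inv, div_le_iff₀ (by positivity)]
      nlinarith [sq_norm_le_entrySq (U x) i j]
    · simp [f, hxS]
  have hfL : ∀ i j, MemLp (f i j) 2 (torusMeasure d) := by
    intro i j
    refine MemLp.of_bound (hfm i j) M ?_
    filter_upwards [hfb i j] with x hx
    refine abs_le_of_sq_le_sq' (hx.trans ?_) hM |>.2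
    by_cases hxS : x ∈ S <;> simp [hxS]; positivity
  have hfI : ∀ i j, √(∫ x, ‖f i j x‖ ^ 2 ∂torusMeasure d) ≤ M * √((torusMeasure d).real S) := by
    intro i j
    rw [← Real.sqrt_sq hM, ← Real.sqrt_mul (by positivity)]
    apply Real.sqrt_le_sqrt
    refine (integral_mono_ae (hfL i j).integrable_norm_pow' ?_ (hfb i j)).trans ?_
    · exact (integrable_const _).indicator hS
    · rw [integral_indicator hS, setIntegral_const, smul_eq_mul, mul_comm]
  choose b hb hbn using fun i j => hC i j (f i j) (hfL i j)
  refine ⟨∑ i, ∑ j, b i j, fun n => ?_, ?_⟩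
  · have h1 : (S.indicator fun _ => 1) =ᵐ[torusMeasure d]
        fun x => ∑ i, ∑ j, U x i j * f i j x := by
      filter_upwards [h] with x hx
      by_cases hxS : x ∈ S
      · have h1 := hx hxS
        have hpos : entrySq (U x) ≠ 0 := by
          intro h0
          rw [h0] at h1; norm_num at h1
        simp only [f, Set.indicator_of_mem hxS]
        simp only [← mul_assoc, ← Finset.sum_mul]
        have h2 : ∑ i, ∑ j, U x i j * star (U x i j) = ((entrySq (U x) : ℝ) : ℂ) := by
          unfold entrySq
          push_cast
          refine Finset.sum_congr rfl fun i _ => Finset.sum_congr rfl fun j _ => ?_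
          exact Complex.mul_conj' _
        rw [h2, ← Complex.ofReal_mul, mul_inv_cancel₀ hpos]; simp
      · simp [f, hxS]
    rw [mFourierCoeff_congr_ae h1, mFourierCoeff_eq]
    have hint : ∀ i j, Integrable (fun x => mFourier (-n) x • (U x i j * f i j x))
        (torusMeasure d) := fun i j =>
      integrable_mFourier_smul ((hUm i j).integrable_mul (hfL i j)) n
    simp only [Finset.smul_sum]
    rw [integral_finsetSum _ fun i _ => integrable_finsetSum _ fun j _ => hint i j]
    simp only [integral_finsetSum _ fun j _ => hint _ j]
    rw [lp.coeFn_sum, Finset.sum_apply]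
    refine Finset.sum_congr rfl fun i _ => ?_
    rw [lp.coeFn_sum, Finset.sum_apply]
    exact Finset.sum_congr rfl fun j _ => hb i j n
  · calc ‖∑ i, ∑ j, b i j‖ ≤ ∑ i : Fin K, ∑ j : Fin K, C * (M * √((torusMeasure d).real S)) :=
        norm_sum_le_of_le _ fun i _ => norm_sum_le_of_le _ fun j _ =>
          (hbn i j).trans (by gcongr; exact hfI i j)
      _ = _ := by simp; ring

/-- On so small a ball the character stays within `1/2` of its value at the centre, so cancellation
costs at most half of the mass. -/
lemma half_measureReal_le_norm_mFourierCoeff_indicator {d : ℕ} (x₀ : Torus d) {r : ℝ}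
    (n : Fin d → ℤ) (hn : 2 * Real.pi * d * ‖n‖ * r ≤ 1 / 2) :
    (torusMeasure d).real (Metric.closedBall x₀ r) / 2
      ≤ ‖mFourierCoeff ((Metric.closedBall x₀ r).indicator fun _ => (1 : ℂ)) n‖ := by
  set S := Metric.closedBall x₀ r with hS
  have hSm : MeasurableSet S := Metric.isClosed_closedBall.measurableSet
  have h1 : mFourierCoeff (S.indicator fun _ => (1 : ℂ)) n
      = ∫ x in S, mFourier (-n) x ∂torusMeasure d := by
    rw [mFourierCoeff_eq, ← integral_indicator hSm]
    congr 1; ext x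
    by_cases hx : x ∈ S <;> simp [hx]
  have h2 : ‖(∫ x in S, mFourier (-n) x ∂torusMeasure d)
      - (torusMeasure d).real S • mFourier (-n) x₀‖ ≤ 1 / 2 * (torusMeasure d).real S := by
    rw [← setIntegral_const, ← integral_sub]
    · refine norm_setIntegral_le_of_norm_le_const (measure_lt_top _ _) fun x hx => ?_
      refine (norm_mFourier_sub_le _ _ _).trans (le_trans ?_ hn)
      rw [norm_neg]
      gcongr
      rwa [hS, mem_closedBall_iff_norm] at hx
    · exact ((memLp_continuousMap (mFourier (-n)) 1).integrable le_rfl).integrableOn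
    · exact integrable_const _
  have h3 : ‖(torusMeasure d).real S • mFourier (-n) x₀‖ = (torusMeasure d).real S := by
    rw [norm_smul, norm_mFourier_apply, mul_one, Real.norm_of_nonneg measureReal_nonneg]
  rw [h1]
  have h4 := norm_sub_norm_le ((torusMeasure d).real S • mFourier (-n) x₀)
    (∫ x in S, mFourier (-n) x ∂torusMeasure d)
  rw [norm_sub_rev, h3] at h4
  linarith

lemma rpow_mul_le_norm_of_forall_le {d : ℕ} {q : ℝ≥0∞} (hq : 1 ≤ q) (b : SeqSpace d q) (N : ℕ)
    {c : ℝ} (hc : 0 ≤ c) (h : ∀ n : Fin d → ℤ, ‖n‖ ≤ N → c ≤ ‖b n‖) :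
    (N : ℝ) ^ (d * q⁻¹.toReal) * c ≤ ‖b‖ := by
  have : Fact (1 ≤ q) := ⟨hq⟩
  have hq0 : q ≠ 0 := (zero_lt_one.trans_le hq).ne'
  by_cases hqt : q = ⊤
  · subst hqt
    simp only [ENNReal.inv_top, ENNReal.toReal_zero, mul_zero, Real.rpow_zero, one_mul]
    exact (h 0 (by simp)).trans (lp.norm_apply_le_norm hq0 b 0)
  · have hqr : 0 < q.toReal := ENNReal.toReal_pos hq0 hqt
    have h1 := lp.sum_rpow_le_norm_rpow hqr b
      -- The cube `{1, …, N}^d` has exactly `N^d` points, all of sup norm at most `N`.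
      (Fintype.piFinset fun _ : Fin d => Finset.Icc (1 : ℤ) N)
    have h2 : (N : ℝ) ^ d * c ^ q.toReal ≤ ‖b‖ ^ q.toReal := by
      refine le_trans ?_ h1
      refine le_trans (le_of_eq ?_) (Finset.card_nsmul_le_sum _ _ (c ^ q.toReal) fun n hn => ?_)
      · simp
      · gcongr
        refine h n ((pi_norm_le_iff_of_nonneg (by positivity)).mpr fun i => ?_)
        have := Fintype.mem_piFinset.mp hn i
        rw [Finset.mem_Icc] at this
        rw [Int.norm_eq_abs, abs_of_nonneg (by exact_mod_cast (by omega : 0 ≤ n i))]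
        exact_mod_cast this.2
    have h3 := Real.rpow_le_rpow (by positivity) h2 (by positivity : 0 ≤ q.toReal⁻¹)
    rw [Real.rpow_rpow_inv (norm_nonneg _) hqr.ne', Real.mul_rpow (by positivity) (by positivity),
      Real.rpow_rpow_inv hc hqr.ne', ← Real.rpow_natCast, ← Real.rpow_mul (by positivity)] at h3
    rwa [ENNReal.toReal_inv]

/-- A multiplier whose size is at least `(η r^{s - d/2})⁻¹` on the `r`-ball, for every `η > 0` and
all small `r`, cannot map into `ℓ^q` with `q ≤ d / (d - s)`. -/
theorem IsMatrixMultiplier.false_of_large {d K : ℕ} {s : ℝ} {q : ℝ≥0∞} (hd : 0 < d) (hq : 1 ≤ q)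
    (hqs : d - s ≤ d * q⁻¹.toReal) {U : Torus d → Matrix (Fin K) (Fin K) ℂ}
    (hU : IsMatrixMultiplier q U) (x₀ : Torus d)
    (h : ∀ η > 0, ∀ᶠ r : ℝ in nhdsWithin 0 (Set.Ioi 0), ∀ᵐ x ∂torusMeasure d,
      ‖x - x₀‖ ≤ r → 1 ≤ (η * r ^ (s - d / 2)) ^ 2 * entrySq (U x)) : False := by
  obtain ⟨C, hC0, hC⟩ := hU.exists_indicator_bound hq
  have hd' : (0 : ℝ) < d := by exact_mod_cast hd
  set e := d * q⁻¹.toReal with he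
  -- The constant in `N^e (2r)^(d/2) = c₀ r^(d/2 - e)` for `r = (4πdN)⁻¹`, the radius that makes
  -- `2πd‖n‖r ≤ 1/2` for all `‖n‖ ≤ N`.
  set c₀ : ℝ := (4 * Real.pi * d)⁻¹ ^ e * 2 ^ ((d : ℝ) / 2) with hc₀
  have hc₀0 : 0 < c₀ := by positivity
  have hlim : Filter.Tendsto (fun N : ℕ => (4 * Real.pi * d)⁻¹ * (N : ℝ)⁻¹) Filter.atTop
      (nhdsWithin 0 (Set.Ioi 0)) := by
    rw [tendsto_nhdsWithin_iff]
    constructor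
    · simpa using (tendsto_inv_atTop_nhds_zero_nat (𝕜 := ℝ)).const_mul ((4 * Real.pi * d)⁻¹)
    · filter_upwards [Filter.eventually_gt_atTop 0] with N hN
      have : (0 : ℝ) < N := by exact_mod_cast hN
      exact Set.mem_Ioi.mpr (by positivity)
  -- The two bounds on `‖b‖` will give `c₀ ≤ 2Cη`, which this value violates.
  set η := c₀ / (4 * (C + 1)) with hη
  obtain ⟨N, hN, hN0, hN1⟩ := ((hlim.eventually (h η (by positivity))).and
    ((Filter.eventually_gt_atTop 0).and (hlim.eventually
      (mem_nhdsWithin_of_mem_nhds (Iic_mem_nhds (by norm_num : (0 : ℝ) < 1 / 2)))))).exists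
  have hN0' : (0 : ℝ) < N := by exact_mod_cast hN0
  set r := (4 * Real.pi * d)⁻¹ * (N : ℝ)⁻¹ with hr
  have hr0 : 0 < r := by positivity
  have hr1 : r ≤ 1 / 2 := hN1
  have hvol : (torusMeasure d).real (Metric.closedBall x₀ r) = (2 * r) ^ d := by
    rw [Measure.real, torusMeasure_closedBall x₀ hr0.le hr1, ENNReal.toReal_ofReal (by positivity)]
  obtain ⟨b, hb, hbn⟩ := hC (Metric.closedBall x₀ r) (η * r ^ (s - d / 2))
    Metric.isClosed_closedBall.measurableSet (by positivity) (by
      filter_upwards [hN] with x hx hxS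
      exact hx (by rwa [mem_closedBall_iff_norm] at hxS))
  have hlow := rpow_mul_le_norm_of_forall_le hq b N (c := (2 * r) ^ d / 2) (by positivity)
    (fun n hn => by
      rw [hb, ← hvol]
      apply half_measureReal_le_norm_mFourierCoeff_indicator
      calc 2 * Real.pi * d * ‖n‖ * r ≤ 2 * Real.pi * d * N * r := by gcongr
        _ = 1 / 2 := by rw [hr]; field_simp; norm_num)
  rw [hvol] at hbn
  have hmain := hlow.trans hbn
  have hNr : (N : ℝ) = (4 * Real.pi * d)⁻¹ * r⁻¹ := by
    rw [hr]; field_simp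
  set v := (2 * r) ^ ((d : ℝ) / 2) with hv
  have hv0 : 0 < v := by positivity
  have hvv : (2 * r) ^ d = v * v := by
    rw [hv, ← Real.rpow_add (by positivity), ← Real.rpow_natCast]; congr 1; ring
  rw [← he, hvv, Real.sqrt_mul_self hv0.le] at hmain
  have h1 : (N : ℝ) ^ e * v ≤ 2 * (C * (η * r ^ (s - d / 2))) := by
    have : ((N : ℝ) ^ e * v) * v ≤ (2 * (C * (η * r ^ (s - d / 2)))) * v := by linarith
    exact le_of_mul_le_mul_right this hv0
  have h2 : (N : ℝ) ^ e * v = c₀ * (r ^ (-e) * r ^ ((d : ℝ) / 2)) := by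
    rw [hv, hNr, Real.mul_rpow (by positivity) (by positivity),
      Real.mul_rpow (by positivity) (by positivity), Real.inv_rpow hr0.le, ← Real.rpow_neg hr0.le]
    ring
  -- Here the condition on `q` enters: `d/2 - e ≤ s - d/2`, and `r ≤ 1`.
  have h3 : r ^ (s - d / 2) ≤ r ^ (-e) * r ^ ((d : ℝ) / 2) := by
    rw [← Real.rpow_add hr0]
    exact Real.rpow_le_rpow_of_exponent_ge hr0 (by linarith) (by linarith)
  set R := r ^ (-e) * r ^ ((d : ℝ) / 2) with hR
  have hR0 : 0 < R := by positivity
  have h4 : c₀ * R ≤ 2 * (C * (η * R)) := by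
    rw [← h2]; exact h1.trans (by gcongr)
  have h5 : c₀ ≤ 2 * (C * η) := le_of_mul_le_mul_right (by linarith) hR0
  have h6 : c₀ = 4 * (C + 1) * η := by rw [hη]; field_simp
  have h7 : 0 < η := by positivity
  nlinarith

/-! ### A zero of the determinant makes the inverse large. -/

lemma continuous_ae_eq_iff {d : ℕ} {f g : Torus d → ℂ} (hf : Continuous f) (hg : Continuous g)
    (h : f =ᵐ[torusMeasure d] g) : f = g :=
  Continuous.ae_eq_iff_eq (torusMeasure d) hf hg |>.mp h

lemma sum_sq_norm_pos {K : ℕ} {v : Fin K → ℂ} (hv : v ≠ 0) : 0 < ∑ i, ‖v i‖ ^ 2 := by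
  obtain ⟨i, hi⟩ := Function.ne_iff.mp hv
  have hi' : 0 < ‖v i‖ := norm_pos_iff.mpr hi
  exact (by positivity : 0 < ‖v i‖ ^ 2).trans_le
    (Finset.single_le_sum (f := fun i => ‖v i‖ ^ 2) (fun _ _ => by positivity) (Finset.mem_univ i))

/-- A right inverse is large when the matrix is small on some vector. -/
lemma one_le_mul_entrySq {K : ℕ} {A U : Matrix (Fin K) (Fin K) ℂ} (hAU : A * U = 1)
    {v : Fin K → ℂ} (hv : v ≠ 0) {t : ℝ} (h : ∑ i, ‖(A *ᵥ v) i‖ ^ 2 ≤ t * ∑ i, ‖v i‖ ^ 2) :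
    1 ≤ t * entrySq U := by
  have h1 := sum_sq_norm_mulVec_le U (A *ᵥ v)
  rw [Matrix.mulVec_mulVec, mul_eq_one_comm.mp hAU, Matrix.one_mulVec] at h1
  have h2 := h1.trans (mul_le_mul_of_nonneg_left h (entrySq_nonneg U))
  have h3 := sum_sq_norm_pos hv
  by_contra! h4
  nlinarith

/-- `eigenvalues` reindexes the ordered list through an arbitrary equivalence, so the two agree only
up to a permutation; this suffices for the determinant and for eigenvectors. -/
lemma eigenvalueDesc_eq {K : ℕ} {A : Matrix (Fin K) (Fin K) ℂ} (hA : A.IsHermitian) :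
    ∃ e : Fin K ≃ Fin K, ∀ k, eigenvalueDesc A k = hA.eigenvalues (e k) := by
  refine ⟨(finCongr (Fintype.card_fin K).symm).trans (Fintype.equivOfCardEq (Fintype.card_fin _)),
    fun k => ?_⟩
  rw [eigenvalueDesc, dif_pos hA]
  simp [Matrix.IsHermitian.eigenvalues]

lemma det_eq_prod_eigenvalueDesc {K : ℕ} {A : Matrix (Fin K) (Fin K) ℂ} (hA : A.IsHermitian) :
    A.det = ∏ k, (eigenvalueDesc A k : ℂ) := by
  obtain ⟨e, he⟩ := eigenvalueDesc_eq hA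
  simp only [he]
  rw [hA.det_eq_prod_eigenvalues, e.prod_comp (fun i => (hA.eigenvalues i : ℂ))]
  rfl

lemma exists_mulVec_eq_eigenvalueDesc {K : ℕ} {A : Matrix (Fin K) (Fin K) ℂ} (hA : A.IsHermitian)
    (k : Fin K) : ∃ v : Fin K → ℂ, v ≠ 0 ∧ A *ᵥ v = (eigenvalueDesc A k : ℂ) • v := by
  obtain ⟨e, he⟩ := eigenvalueDesc_eq hA
  refine ⟨hA.eigenvectorBasis (e k), fun h0 => ?_, ?_⟩
  · have h1 := hA.eigenvectorBasis.orthonormal.ne_zero (e k)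
    apply h1
    ext i
    exact congrFun h0 i
  · rw [hA.mulVec_eigenvectorBasis, he]; rfl

/-- `det W` having a zero contradicts `W⁻¹ ∈ 𝔐_2^q(K)`, for Hermitian `W` with Sobolev
eigenvalues. -/
theorem HermitianWithSobolevEigenvalues.not_inverseIsMultiplier {d K : ℕ} {s : ℝ} {q : ℝ≥0∞}
    {W : Torus d → Matrix (Fin K) (Fin K) ℂ} (hd : 0 < d) (hs : (d : ℝ) / 2 < s)
    (hs1 : s < (d : ℝ) / 2 + 1) (hW : HermitianWithSobolevEigenvalues s W)
    (hdet : HasZero fun x => (W x).det) (hq : 1 ≤ q) (hqs : d - s ≤ d * q⁻¹.toReal) :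
    ¬ InverseIsMultiplier q W := by
  rintro ⟨U, hWU, hU⟩
  obtain ⟨-, hherm, hsob⟩ := hW
  obtain ⟨g, hg, hgW, x₀, hx₀⟩ := hdet
  choose F hF hFr using fun k => (hsob k).exists_continuousMap hs hs1
  have hF' := ae_all_iff.mpr hF
  -- Both sides are continuous and agree almost everywhere, so the zero of `g` is a zero of one
  -- eigenvalue's continuous representative.
  have hgF : g = fun x => ∏ k, F k x := by
    refine continuous_ae_eq_iff hg (by fun_prop) ?_
    filter_upwards [hgW, hherm, hF'] with x h1 h2 h3
    rw [h1, det_eq_prod_eigenvalueDesc h2]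
    simp only [h3]
  rw [hgF] at hx₀
  obtain ⟨k, -, hk⟩ := Finset.prod_eq_zero_iff.mp hx₀
  refine hU.false_of_large hd hq hqs x₀ fun η hη => ?_
  filter_upwards [hFr k x₀ η hη] with r hr
  filter_upwards [hWU, hherm, hF'] with x h1 h2 h3 hxr
  obtain ⟨v, hv, hvk⟩ := exists_mulVec_eq_eigenvalueDesc h2 k
  refine one_le_mul_entrySq h1 hv ?_
  have h4 := hr x hxr
  rw [hk, sub_zero, h3 k] at h4
  rw [hvk, Finset.mul_sum]
  refine Finset.sum_le_sum fun i _ => ?_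
  rw [Pi.smul_apply, smul_eq_mul, norm_mul, mul_pow]
  gcongr

/-- `det W` having a zero contradicts `W⁻¹ ∈ 𝔐_2^q(K)`, for nonnegative `W` with Sobolev
entries. -/
theorem NonnegWithSobolevEntries.not_inverseIsMultiplier {d K : ℕ} {s : ℝ} {q : ℝ≥0∞}
    {W : Torus d → Matrix (Fin K) (Fin K) ℂ} (hd : 0 < d) (hs : (d : ℝ) / 2 < s)
    (hs1 : s < (d : ℝ) / 2 + 1) (hW : NonnegWithSobolevEntries s W)
    (hdet : HasZero fun x => (W x).det) (hq : 1 ≤ q) (hqs : d - s ≤ d * q⁻¹.toReal) :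
    ¬ InverseIsMultiplier q W := by
  rintro ⟨U, hWU, hU⟩
  obtain ⟨-, hsob⟩ := hW
  obtain ⟨g, hg, hgW, x₀, hx₀⟩ := hdet
  choose F hF hFr using fun i j => (hsob i j).exists_continuousMap hs hs1
  have hF' := ae_all_iff.mpr fun i => ae_all_iff.mpr fun j => hF i j
  let G : Torus d → Matrix (Fin K) (Fin K) ℂ := fun x => Matrix.of fun i j => F i j x
  have hGW : ∀ᵐ x ∂torusMeasure d, G x = W x := by
    filter_upwards [hF'] with x hx
    ext i j
    exact hx i j
  have hgG : g = fun x => (G x).det := by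
    refine continuous_ae_eq_iff hg ?_ ?_
    · exact Continuous.matrix_det (continuous_matrix fun i j => (F i j).continuous)
    · filter_upwards [hgW, hGW] with x h1 h2
      rw [h1, h2]
  rw [hgG] at hx₀
  -- The vector `v` does not depend on `x`: since `G x₀ *ᵥ v = 0`, `W x *ᵥ v` is controlled by the
  -- increment `G x - G x₀`.
  obtain ⟨v, hv, hv0⟩ := Matrix.exists_mulVec_eq_zero_iff.mpr hx₀
  refine hU.false_of_large hd hq hqs x₀ fun η hη => ?_
  -- Dividing by `K + 1` lets the `K²` squared entries add up to at most `(η r^(s - d/2))²`.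
  have hev : ∀ᶠ r in nhdsWithin (0 : ℝ) (Set.Ioi 0), ∀ i j, ∀ x, ‖x - x₀‖ ≤ r →
      ‖F i j x - F i j x₀‖ ≤ η / (K + 1) * r ^ (s - d / 2) := by
    rw [Filter.eventually_all]; intro i
    rw [Filter.eventually_all]; intro j
    exact hFr i j x₀ _ (by positivity)
  filter_upwards [hev, self_mem_nhdsWithin] with r hr hr0
  have hr0' : (0 : ℝ) < r := hr0
  filter_upwards [hWU, hGW] with x h1 h2 hxr
  refine one_le_mul_entrySq h1 hv ?_
  have h3 : W x *ᵥ v = (G x - G x₀) *ᵥ v := by rw [Matrix.sub_mulVec, hv0, sub_zero, h2]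
  rw [h3]
  refine (sum_sq_norm_mulVec_le _ v).trans ?_
  gcongr
  calc entrySq (G x - G x₀)
      ≤ ∑ _i : Fin K, ∑ _j : Fin K, (η / (K + 1) * r ^ (s - (d : ℝ) / 2)) ^ 2 := by
        unfold entrySq
        gcongr with i _ j _
        exact hr i j x hxr
    _ = (K / (K + 1) * (η * r ^ (s - (d : ℝ) / 2))) ^ 2 := by simp; ring
    _ ≤ (1 * (η * r ^ (s - (d : ℝ) / 2))) ^ 2 := by
        gcongr
        rw [div_le_one (by positivity)]; linarith
    _ = _ := by rw [one_mul]

/-! ### Functions in `L^p` as scalar multipliers. -/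

/-- Scalar `(2,q)`-multipliers. -/
def IsScalarMultiplier {d : ℕ} (q : ℝ≥0∞) (u : Torus d → ℂ) : Prop :=
  ∃ C : ℝ, 0 ≤ C ∧ ∀ f : Torus d → ℂ, MemLp f 2 (torusMeasure d) →
    ∃ b : SeqSpace d q, (∀ n, b n = mFourierCoeff (fun x => u x * f x) n) ∧
      ‖b‖ ≤ C * √(∫ x, ‖f x‖ ^ 2 ∂torusMeasure d)

lemma IsScalarMultiplier.isMatrixMultiplier {d K : ℕ} {q : ℝ≥0∞} (hq : 1 ≤ q) {u : Torus d → ℂ}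
    (hu : IsScalarMultiplier q u) (hu2 : MemLp u 2 (torusMeasure d)) :
    IsMatrixMultiplier q fun x => u x • (1 : Matrix (Fin K) (Fin K) ℂ) := by
  have : Fact (1 ≤ q) := ⟨hq⟩
  obtain ⟨C, hC0, hC⟩ := hu
  refine ⟨fun i j => ?_, K * C, fun A => ?_⟩
  · by_cases hij : i = j
    · subst hij; simpa using hu2
    · simp [hij]
  · choose b hb hbn using fun i => hC (invFourier (A i)) (memLp_invFourier (A i))
    refine ⟨WithLp.toLp q b, fun i n => ?_, ?_⟩
    · rw [multiplierOp]
      simp only [Matrix.smul_mulVec, Matrix.one_mulVec, Pi.smul_apply, smul_eq_mul]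
      exact hb i n
    · have h1 : WithLp.toLp q b = ∑ i, PiLp.single q i (b i) := by
        ext j : 1
        simp
      rw [h1]
      refine (norm_sum_le _ _).trans ?_
      refine (Finset.sum_le_card_nsmul _ _ (C * ‖A‖) fun i _ => ?_).trans (by simp [mul_assoc])
      rw [PiLp.norm_single]
      refine (hbn i).trans ?_
      rw [integral_sq_norm_invFourier, Real.sqrt_sq (norm_nonneg _)]
      gcongr
      exact PiLp.norm_apply_le A i

lemma integral_norm_mul_le {d : ℕ} {f g : Torus d → ℂ} (hf : MemLp f 2 (torusMeasure d))
    (hg : MemLp g 2 (torusMeasure d)) :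
    ∫ x, ‖f x * g x‖ ∂torusMeasure d
      ≤ √(∫ x, ‖f x‖ ^ 2 ∂torusMeasure d) * √(∫ x, ‖g x‖ ^ 2 ∂torusMeasure d) := by
  have h := integral_mul_norm_le_Lp_mul_Lq (μ := torusMeasure d) (f := f) (g := g)
    Real.HolderConjugate.two_two (by simpa using hf) (by simpa using hg)
  simpa [Real.sqrt_eq_rpow] using h

/-- By Cauchy–Schwarz `u * f` is in `L¹`, so its coefficients are bounded. -/
lemma isScalarMultiplier_top {d : ℕ} {u : Torus d → ℂ} (hu : MemLp u 2 (torusMeasure d)) :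
    IsScalarMultiplier ⊤ u := by
  refine ⟨√(∫ x, ‖u x‖ ^ 2 ∂torusMeasure d), by positivity, fun f hf => ?_⟩
  have h1 : ∀ n, ‖mFourierCoeff (fun x => u x * f x) n‖ ≤ _ := fun n =>
    (norm_mFourierCoeff_le _ n).trans (integral_norm_mul_le hu hf)
  refine ⟨⟨fun n => mFourierCoeff (fun x => u x * f x) n, ?_⟩, fun n => rfl, ?_⟩
  · exact memℓp_infty ⟨_, by rintro _ ⟨n, rfl⟩; exact h1 n⟩
  · exact lp.norm_le_of_forall_le (by positivity) h1

/-- `L^p(𝕋ᵈ)` consists of `(2,q)`-multipliers if `1/q < 1/2 - 1/p`. -/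
theorem isScalarMultiplier_of_memLp {d : ℕ} {p Q : ℝ} (hp : 2 < p) (hQ : 2 < Q)
    (hpQ : 4 < (p - 2) * (Q - 2)) {u : Torus d → ℂ} (hum : Measurable u)
    (hu : MemLp u (ENNReal.ofReal p) (torusMeasure d)) :
    IsScalarMultiplier (ENNReal.ofReal Q) u := by
  set μ := torusMeasure d
  have hu2 : MemLp u 2 μ := hu.mono_exponent (by
    rw [← ENNReal.ofReal_ofNat]; exact ENNReal.ofReal_le_ofReal hp.le)
  -- Where `|u| > 2^j` one has `|u|² ≤ |u|^p 2^(-j(p-2))`, so the part of `u` above height `2^j` has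
  -- `L²` norm `O(2^(-βj))`.
  set β := (p - 2) / 2 with hβ
  have hβ0 : 0 < β := by rw [hβ]; linarith
  set R := ∫ x, ‖u x‖ ^ p ∂μ with hR
  have hR0 : 0 ≤ R := integral_nonneg fun x => by positivity
  have hRint : Integrable (fun x => ‖u x‖ ^ p) μ := by
    have := hu.integrable_norm_rpow (by simp; linarith) ENNReal.ofReal_ne_top
    rwa [ENNReal.toReal_ofReal (by linarith)] at this
  let D : ℝ := √(∫ x, ‖u x‖ ^ 2 ∂μ) + 2 * 2 ^ β * √R
  have hD0 : 0 ≤ D := by positivity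
  let S : ℕ → Set (Torus d) := fun j => {x | ‖u x‖ ≤ 2 ^ j}
  have hS : ∀ j, MeasurableSet (S j) := fun j => measurableSet_le hum.norm measurable_const
  have hhigh : ∀ j, √(∫ x, ‖(S j)ᶜ.indicator u x‖ ^ 2 ∂μ) ≤ √R * 2 ^ (-(β * j)) := by
    intro j
    have h1 : ∫ x, ‖(S j)ᶜ.indicator u x‖ ^ 2 ∂μ ≤ R * 2 ^ (-(2 * (β * j))) := by
      rw [hR, ← integral_mul_const]
      refine integral_mono_ae (hu2.indicator (hS j).compl).integrable_norm_pow'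
        (hRint.mul_const _) (ae_of_all _ fun x => ?_)
      by_cases hx : x ∈ S j
      · simp only [Set.indicator_of_notMem (Set.notMem_compl_iff.mpr hx), norm_zero]
        rw [zero_pow two_ne_zero]; positivity
      · simp only [Set.indicator_of_mem (Set.mem_compl hx)]
        have hx' : (2 : ℝ) ^ j < ‖u x‖ := not_le.mp hx
        have h0 : 0 < ‖u x‖ := lt_trans (by positivity) hx'
        have h2 : ((2 : ℝ) ^ j) ^ (p - 2) ≤ ‖u x‖ ^ (p - 2) :=
          Real.rpow_le_rpow (by positivity) hx'.le (by linarith)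
        have h3 : ‖u x‖ ^ p = ‖u x‖ ^ 2 * ‖u x‖ ^ (p - 2) := by
          rw [← Real.rpow_natCast, ← Real.rpow_add h0]; congr 1; push_cast; ring
        have h4 : ((2 : ℝ) ^ j) ^ (p - 2) = (2 : ℝ) ^ (2 * (β * j)) := by
          rw [← Real.rpow_natCast, ← Real.rpow_mul (by norm_num)]; congr 1; rw [hβ]; ring
        rw [h4] at h2
        rw [Real.rpow_neg (by norm_num), ← div_eq_mul_inv, le_div_iff₀ (by positivity), h3]
        gcongr
    refine (Real.sqrt_le_sqrt h1).trans (le_of_eq ?_)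
    rw [Real.sqrt_mul hR0, Real.sqrt_eq_rpow ((2 : ℝ) ^ _), ← Real.rpow_mul (by norm_num)]
    congr 2; ring
  -- Height `j` will contribute `2^(-βj(Q-2)) * 4^j = 2^(-δj)`. Positivity of `δ` is `hpQ`, that is
  -- `1/p + 1/Q < 1/2`.
  let δ : ℝ := β * (Q - 2) - 2
  have hδ0 : 0 < δ := by simp only [δ, hβ]; linarith
  have hgeo : Summable fun j : ℕ => (2 : ℝ) ^ (-(δ * j)) := by
    have : (fun j : ℕ => (2 : ℝ) ^ (-(δ * j))) = fun j : ℕ => ((2 : ℝ) ^ (-δ)) ^ j := by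
      ext j; rw [← Real.rpow_natCast, ← Real.rpow_mul (by norm_num)]; congr 1; ring
    rw [this]
    exact summable_geometric_of_lt_one (by positivity)
      (Real.rpow_lt_one_of_one_lt_of_neg (by norm_num) (by linarith))
  let G := ∑' j : ℕ, (2 : ℝ) ^ (-(δ * j))
  have hG0 : 0 ≤ G := tsum_nonneg fun j => by positivity
  let E : ℝ := 4 * D ^ (Q - 2) * G
  have hE0 : 0 ≤ E := by positivity
  refine ⟨E ^ Q⁻¹, by positivity, fun f hf => ?_⟩
  set M := √(∫ x, ‖f x‖ ^ 2 ∂μ) with hM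
  have hM0 : 0 ≤ M := Real.sqrt_nonneg _
  let c := fun n => mFourierCoeff (fun x => u x * f x) n
  let a := fun (j : ℕ) n => mFourierCoeff (fun x => (S j).indicator u x * f x) n
  have hlowb : ∀ j x, ‖(S j).indicator u x‖ ≤ 2 ^ j := by
    intro j x
    by_cases hx : x ∈ S j
    · rw [Set.indicator_of_mem hx]; exact hx
    · rw [Set.indicator_of_notMem hx, norm_zero]; positivity
  have haL : ∀ j, MemLp (fun x => (S j).indicator u x * f x) 2 μ := by
    intro j
    refine (hf.const_mul ((2 : ℂ) ^ j)).mono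
      ((hum.indicator (hS j)).aestronglyMeasurable.mul hf.1) (ae_of_all _ fun x => ?_)
    rw [norm_mul, norm_mul, norm_pow, Complex.norm_ofNat]
    gcongr
    exact hlowb j x
  have hasum : ∀ j, (Summable fun n => ‖a j n‖ ^ 2) ∧ ∑' n, ‖a j n‖ ^ 2 ≤ 4 ^ j * M ^ 2 := by
    intro j
    have h1 := hasSum_sq_norm_mFourierCoeff (haL j)
    refine ⟨h1.summable, h1.tsum_eq.trans_le ?_⟩
    rw [hM, Real.sq_sqrt (integral_nonneg fun x => by positivity), ← integral_const_mul]
    refine integral_mono_ae (haL j).integrable_norm_pow'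
      (hf.integrable_norm_pow'.const_mul _) (ae_of_all _ fun x => ?_)
    simp only [norm_mul, mul_pow]
    gcongr
    calc ‖(S j).indicator u x‖ ^ 2 ≤ (2 ^ j) ^ 2 := by gcongr; exact hlowb j x
      _ = 4 ^ j := by rw [← pow_mul, mul_comm, pow_mul]; norm_num
  have hca : ∀ j n, ‖c n - a j n‖ ≤ √R * 2 ^ (-(β * j)) * M := by
    intro j n
    have h1 : c n - a j n = mFourierCoeff (fun x => (S j)ᶜ.indicator u x * f x) n := by
      simp only [c, a]
      rw [mFourierCoeff_eq, mFourierCoeff_eq, mFourierCoeff_eq, ← integral_sub]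
      · congr 1; ext x
        by_cases hx : x ∈ S j <;> simp [hx]
      · exact integrable_mFourier_smul (hu2.integrable_mul hf) n
      · exact integrable_mFourier_smul ((haL j).integrable (by norm_num)) n
    rw [h1]
    refine (norm_mFourierCoeff_le _ n).trans ?_
    refine (integral_norm_mul_le (hu2.indicator (hS j).compl) hf).trans ?_
    gcongr
    exact hhigh j
  have hcD : ∀ n, ‖c n‖ ≤ √(∫ x, ‖u x‖ ^ 2 ∂μ) * M := fun n =>
    (norm_mFourierCoeff_le _ n).trans (integral_norm_mul_le hu2 hf)
  -- Interpolation by hand: at each frequency take the first height `j` where the bound for the high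
  -- part is below `|c n| / 2`. Then `|c n| ≤ 2|a j n|`, while minimality of `j` (or the `L²` bound
  -- if `j = 0`) gives `|c n| ≤ D M 2^(-βj)`. Using the latter for `Q - 2` powers leaves an `ℓ²` sum
  -- of `a j`.
  have hkey : ∀ n, c n ≠ 0 → ∃ j : ℕ,
      ‖c n‖ ^ Q ≤ 4 * (D * M * 2 ^ (-(β * j))) ^ (Q - 2) * ‖a j n‖ ^ 2 := by
    intro n hn
    have hc0 : 0 < ‖c n‖ := norm_pos_iff.mpr hn
    have hex : ∃ j : ℕ, 2 * (√R * 2 ^ (-(β * j)) * M) < ‖c n‖ := by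
      have h1 : Filter.Tendsto (fun j : ℕ => 2 * (√R * ((2 : ℝ) ^ (-β)) ^ j * M)) Filter.atTop
          (nhds (2 * (√R * 0 * M))) :=
        (((tendsto_pow_atTop_nhds_zero_of_lt_one (by positivity)
          (Real.rpow_lt_one_of_one_lt_of_neg (by norm_num) (by linarith))).const_mul _).mul_const
            _).const_mul _
      rw [mul_zero, zero_mul, mul_zero] at h1
      obtain ⟨j, hj⟩ := (h1.eventually (gt_mem_nhds hc0)).exists
      refine ⟨j, ?_⟩
      rwa [← Real.rpow_natCast, ← Real.rpow_mul (by norm_num), neg_mul] at hj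
    classical
    obtain ⟨j, hj, hmin⟩ : ∃ j : ℕ, 2 * (√R * 2 ^ (-(β * j)) * M) < ‖c n‖ ∧
        ∀ i < j, ‖c n‖ ≤ 2 * (√R * 2 ^ (-(β * i)) * M) :=
      ⟨Nat.find hex, Nat.find_spec hex, fun i hi => not_lt.mp (Nat.find_min hex hi)⟩
    refine ⟨j, ?_⟩
    have h1 : ‖c n‖ ≤ 2 * ‖a j n‖ := by
      have := norm_sub_norm_le (c n) (a j n)
      have := hca j n
      linarith
    have h2 : ‖c n‖ ≤ D * M * 2 ^ (-(β * j)) := by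
      rcases j with _ | i
      · simp only [CharP.cast_eq_zero, mul_zero, neg_zero, Real.rpow_zero, mul_one]
        refine (hcD n).trans ?_
        gcongr
        simp only [D]
        have : 0 ≤ 2 * 2 ^ β * √R := by positivity
        linarith
      · refine (hmin i (Nat.lt_succ_self i)).trans ?_
        have h3 : (2 : ℝ) ^ (-(β * i)) = 2 ^ β * 2 ^ (-(β * (i + 1 : ℕ))) := by
          rw [← Real.rpow_add (by norm_num)]; congr 1; push_cast; ring
        rw [h3]
        calc 2 * (√R * (2 ^ β * 2 ^ (-(β * (i + 1 : ℕ)))) * M)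
            = (2 * 2 ^ β * √R) * M * 2 ^ (-(β * (i + 1 : ℕ))) := by ring
          _ ≤ _ := by
            gcongr
            simp only [D]
            have : 0 ≤ √(∫ x, ‖u x‖ ^ 2 ∂μ) := by positivity
            linarith
    calc ‖c n‖ ^ Q = ‖c n‖ ^ (Q - 2) * ‖c n‖ ^ 2 := by
          rw [← Real.rpow_natCast, ← Real.rpow_add hc0]; congr 1; push_cast; ring
      _ ≤ (D * M * 2 ^ (-(β * j))) ^ (Q - 2) * (2 * ‖a j n‖) ^ 2 := by
          gcongr
      _ = _ := by ring
  have hterm : ∀ n, ENNReal.ofReal (‖c n‖ ^ Q) ≤ ∑' j : ℕ,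
      ENNReal.ofReal (4 * (D * M * 2 ^ (-(β * j))) ^ (Q - 2) * ‖a j n‖ ^ 2) := by
    intro n
    by_cases hn : c n = 0
    · rw [hn, norm_zero, Real.zero_rpow (by linarith)]; simp
    · obtain ⟨j, hj⟩ := hkey n hn
      exact (ENNReal.ofReal_le_ofReal hj).trans (ENNReal.le_tsum j)
  have htot : ∑' n, ENNReal.ofReal (‖c n‖ ^ Q) ≤ ENNReal.ofReal (E * M ^ Q) := by
    refine (ENNReal.tsum_le_tsum hterm).trans ?_
    rw [ENNReal.tsum_comm]
    have h1 : ∀ j : ℕ, ∑' n, ENNReal.ofReal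
        (4 * (D * M * 2 ^ (-(β * j))) ^ (Q - 2) * ‖a j n‖ ^ 2)
        ≤ ENNReal.ofReal (4 * D ^ (Q - 2) * M ^ Q * 2 ^ (-(δ * j))) := by
      intro j
      rw [← ENNReal.ofReal_tsum_of_nonneg (fun n => by positivity) ((hasum j).1.mul_left _),
        tsum_mul_left]
      apply ENNReal.ofReal_le_ofReal
      calc _ ≤ 4 * (D * M * 2 ^ (-(β * j))) ^ (Q - 2) * (4 ^ j * M ^ 2) := by
            gcongr; exact (hasum j).2
        _ = _ := by
          have h2 : M ^ Q = M ^ (Q - 2) * M ^ 2 := by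
            rw [← Real.rpow_natCast, ← Real.rpow_add' hM0 (by push_cast; linarith)]
            congr 1; push_cast; ring
          have h3 : (2 : ℝ) ^ (-(δ * j)) = (2 ^ (-(β * j))) ^ (Q - 2) * 4 ^ j := by
            have : (4 : ℝ) ^ j = 2 ^ (2 * j : ℝ) := by
              rw [Real.rpow_mul (by norm_num), Real.rpow_natCast]; norm_num
            rw [this, ← Real.rpow_mul (by norm_num), ← Real.rpow_add (by norm_num)]
            congr 1; simp only [δ]; ring
          rw [h2, h3, Real.mul_rpow (by positivity) (by positivity), Real.mul_rpow hD0 hM0]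
          ring
    refine (ENNReal.tsum_le_tsum h1).trans (le_of_eq ?_)
    rw [← ENNReal.ofReal_tsum_of_nonneg (fun n => by positivity) (hgeo.mul_left _), tsum_mul_left]
    congr 1
    simp only [E, G]; ring
  have hsum : Summable fun n => ‖c n‖ ^ Q := by
    refine (ENNReal.summable_toReal (ne_top_of_le_ne_top ENNReal.ofReal_ne_top htot)).congr
      fun n => ?_
    rw [ENNReal.toReal_ofReal (by positivity)]
  have hQr : (ENNReal.ofReal Q).toReal = Q := ENNReal.toReal_ofReal (by linarith)
  have hmem : Memℓp c (ENNReal.ofReal Q) := by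
    refine memℓp_gen ?_
    rw [hQr]; exact hsum
  refine ⟨⟨c, hmem⟩, fun n => rfl, ?_⟩
  have hnorm := lp.norm_rpow_eq_tsum (p := ENNReal.ofReal Q) (by rw [hQr]; linarith)
    (⟨c, hmem⟩ : SeqSpace d (ENNReal.ofReal Q))
  rw [hQr] at hnorm
  have h1 : ‖(⟨c, hmem⟩ : SeqSpace d (ENNReal.ofReal Q))‖ ^ Q ≤ E * M ^ Q := by
    rw [hnorm]
    rw [← ENNReal.ofReal_tsum_of_nonneg (fun n => by positivity) hsum,
      ENNReal.ofReal_le_ofReal_iff (by positivity)] at htot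
    exact htot
  have h2 := Real.rpow_le_rpow (Real.rpow_nonneg (lp.norm_nonneg' _) Q) h1
    (by positivity : 0 ≤ Q⁻¹)
  rwa [Real.rpow_rpow_inv (lp.norm_nonneg' _) (by linarith), Real.mul_rpow hE0 (by positivity),
    Real.rpow_rpow_inv hM0 (by linarith)] at h2

/-! ### A Sobolev function with a zero of prescribed order. -/

/-- The case `m = 0` of `exists_tsum_min_le`, where the minimum is `1` for `k ≠ 0`; capping `t` at
`d + 1` keeps the parameter in its range. -/
lemma summable_norm_rpow_neg {d : ℕ} {t : ℝ} (ht : (d : ℝ) < t) :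
    Summable fun k : Fin d → ℤ => ‖k‖ ^ (-t) := by
  have hd : (0 : ℝ) ≤ d := by positivity
  obtain ⟨C, hC, h⟩ := exists_tsum_min_le (d := d) (s := min t (d + 1) / 2)
    (by have := lt_min ht (lt_add_one (d : ℝ)); linarith)
    (by have := min_le_right t ((d : ℝ) + 1); linarith)
  have h1 := ENNReal.summable_toReal (ne_top_of_le_ne_top ENNReal.ofReal_ne_top (h 0))
  refine h1.of_nonneg_of_le (fun k => by positivity) fun k => ?_
  rw [ENNReal.toReal_ofReal (by positivity)]
  by_cases hk : k = 0
  · subst hk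
    rw [norm_zero, Real.zero_rpow (by linarith)]
    positivity
  · have hk1 := one_le_norm_of_ne_zero hk
    rw [neg_zero, zpow_zero, mul_one, min_eq_left hk1, one_pow, mul_one]
    refine Real.rpow_le_rpow_of_exponent_le hk1 ?_
    have := min_le_left t ((d : ℝ) + 1)
    linarith

/-- `|e^{2πit} - 1| = 2|sin πt|`, and Jordan's inequality applies for `|t| ≤ 1/2`. -/
lemma four_mul_norm_le (z : UnitAddCircle) : 4 * ‖z‖ ≤ ‖fourier 1 z - 1‖ := by
  obtain ⟨t, rfl, ht⟩ := exists_real_lift z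
  have h2 : |t| ≤ 1 / 2 := by
    rw [ht]
    simpa using AddCircle.norm_le_half_period (1 : ℝ) (x := (t : UnitAddCircle)) one_ne_zero
  have h1 : fourier 1 (t : UnitAddCircle) = Complex.exp (Complex.I * ((2 * Real.pi * t : ℝ) : ℂ)) := by
    rw [fourier_coe_apply]
    congr 1
    push_cast; ring
  rw [h1, Complex.norm_exp_I_mul_ofReal_sub_one, ← ht, norm_mul, Real.norm_ofNat, Real.norm_eq_abs]
  have hπ := Real.pi_pos
  have h3 := Real.mul_abs_le_abs_sin (x := 2 * Real.pi * t / 2) (by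
    rw [show 2 * Real.pi * t / 2 = Real.pi * t by ring, abs_mul, abs_of_pos hπ]
    nlinarith)
  have h4 : 2 / Real.pi * |2 * Real.pi * t / 2| = 2 * |t| := by
    rw [show 2 * Real.pi * t / 2 = Real.pi * t by ring, abs_mul, abs_of_pos hπ]
    field_simp
  linarith

lemma norm_sum_fourier_le (z : UnitAddCircle) (N : ℕ) :
    ‖∑ m ∈ Finset.range N, fourier (m : ℤ) z‖ ≤ N ∧
      2 * ‖z‖ * ‖∑ m ∈ Finset.range N, fourier (m : ℤ) z‖ ≤ 1 := by
  have hn : ∀ m : ℤ, ‖fourier m z‖ = 1 := fun m => by rw [fourier_apply, Circle.norm_coe]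
  constructor
  · refine (norm_sum_le _ _).trans ?_
    simp only [hn]; simp
  · have h1 : ∀ m : ℕ, fourier (m : ℤ) z = fourier 1 z ^ m := by
      intro m
      rw [fourier_apply, fourier_one, natCast_zsmul, AddCircle.toCircle_nsmul]; simp
    simp only [h1]
    have h2 := congrArg norm (mul_geom_sum (fourier 1 z) N)
    rw [norm_mul] at h2
    have h3 : ‖fourier 1 z ^ N - 1‖ ≤ 2 := by
      refine (norm_sub_le _ _).trans ?_
      rw [norm_pow, hn]; norm_num
    have h4 := four_mul_norm_le z
    nlinarith [norm_nonneg (∑ m ∈ Finset.range N, fourier 1 z ^ m)]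

/-- The box `{0, …, N - 1}ᵈ`. -/
def latticeBox (d N : ℕ) : Finset (Fin d → ℤ) :=
  Fintype.piFinset fun _ => (Finset.range N).map Nat.castEmbedding

lemma norm_le_of_mem_latticeBox {d N : ℕ} {k : Fin d → ℤ} (hk : k ∈ latticeBox d N) :
    ‖k‖ ≤ N := by
  refine (pi_norm_le_iff_of_nonneg (by positivity)).mpr fun i => ?_
  have := Fintype.mem_piFinset.mp hk i
  simp only [Finset.mem_map, Finset.mem_range, Nat.castEmbedding_apply] at this
  obtain ⟨m, hm, hmk⟩ := this
  rw [← hmk, Int.norm_natCast]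
  exact_mod_cast hm.le

lemma card_latticeBox (d N : ℕ) : (latticeBox d N).card = N ^ d := by
  simp [latticeBox]

/-- The sum factors into geometric sums. A coordinate with `‖x i‖ = ‖x‖` contributes at most `1 /
(2‖x‖) ≤ N / 2`, the others at most `N`. Hence `1 - Re e_k(x)` averages at least `1/2` over the box.
-/
lemma norm_sum_latticeBox_le {d N : ℕ} {x : Torus d} (hx : x ≠ 0) (hN : ‖x‖⁻¹ ≤ N) :
    ‖∑ k ∈ latticeBox d N, mFourier k x‖ ≤ (N : ℝ) ^ d / 2 := by
  have hx0 : 0 < ‖x‖ := norm_pos_iff.mpr hx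
  have hd : Nonempty (Fin d) := by
    by_contra h
    rw [not_nonempty_iff] at h
    exact hx (Subsingleton.elim _ _)
  obtain ⟨i, hi⟩ : ∃ i, ‖x i‖ = ‖x‖ := by
    obtain ⟨i, -, hi⟩ := Finset.exists_mem_eq_sup' Finset.univ_nonempty fun i => ‖x i‖
    refine ⟨i, le_antisymm (norm_le_pi_norm x i) ?_⟩
    refine (pi_norm_le_iff_of_nonneg (norm_nonneg _)).mpr fun j => ?_
    rw [← hi]
    exact Finset.le_sup' (fun i => ‖x i‖) (Finset.mem_univ j)
  have h1 : ∑ k ∈ latticeBox d N, mFourier k x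
      = ∏ i, ∑ m ∈ Finset.range N, fourier (m : ℤ) (x i) := by
    have := Finset.prod_univ_sum (fun _ : Fin d => (Finset.range N).map Nat.castEmbedding)
      (fun i (m : ℤ) => fourier m (x i))
    simp only [Finset.sum_map, Nat.castEmbedding_apply] at this
    rw [this]; rfl
  have h2 : ‖∑ m ∈ Finset.range N, fourier (m : ℤ) (x i)‖ ≤ N / 2 := by
    have h3 := (norm_sum_fourier_le (x i) N).2
    rw [hi] at h3
    have h4 : ‖∑ m ∈ Finset.range N, fourier (m : ℤ) (x i)‖ ≤ ‖x‖⁻¹ / 2 := by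
      rw [show ‖x‖⁻¹ / 2 = 1 / (2 * ‖x‖) by field_simp, le_div_iff₀ (by positivity)]
      linarith
    linarith
  rw [h1, norm_prod, ← Finset.mul_prod_erase _ _ (Finset.mem_univ i)]
  calc _ ≤ (N / 2 : ℝ) * ∏ _j ∈ Finset.univ.erase i, (N : ℝ) := by
        gcongr with j _
        exact (norm_sum_fourier_le (x j) N).1
    _ = (N : ℝ) ^ d / 2 := by
        rw [Finset.prod_const, Finset.card_erase_of_mem (Finset.mem_univ i), Finset.card_univ,
          Fintype.card_fin]
        obtain ⟨n, rfl⟩ : ∃ n, d = n + 1 := Nat.exists_eq_succ_of_ne_zero i.pos.ne'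
        rw [Nat.add_sub_cancel, pow_succ]; ring

lemma norm_torus_le {d : ℕ} (x : Torus d) : ‖x‖ ≤ 1 / 2 := by
  refine (pi_norm_le_iff_of_nonneg (by norm_num)).mpr fun i => ?_
  simpa using AddCircle.norm_le_half_period (1 : ℝ) (x := x i) one_ne_zero

/-- A nonnegative function in `W^{s,2}(𝕋ᵈ)` that vanishes at `0` and is at least of order
`|x|^α`, for any `α > s - d/2`. -/
theorem exists_memSobolev_ge_rpow (d : ℕ) {s α : ℝ} (hs : 0 < s) (hα0 : 0 < α)
    (hα : s - d / 2 < α) :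
    ∃ w : Torus d → ℝ, Continuous w ∧ w 0 = 0 ∧ MemSobolev s (fun x => (w x : ℂ)) ∧
      ∃ c > 0, ∀ x, c * ‖x‖ ^ α ≤ w x := by
  have hd : (0 : ℝ) ≤ d := by positivity
  -- The function is `w = ∑ c_k (1 - Re e_k)`. Its Sobolev sum is dominated by `∑ ‖k‖^(2s - 2d -
  -- 2α)`, which converges because `α > s - d/2`.
  let c : (Fin d → ℤ) → ℝ := fun k => ‖k‖ ^ (-(d + α))
  have hc0 : ∀ k, 0 ≤ c k := fun k => by positivity
  have hc00 : c 0 = 0 := by simp only [c]; rw [norm_zero, Real.zero_rpow (by linarith)]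
  have hcs : Summable c := summable_norm_rpow_neg (by linarith)
  set S := ∑' k, c k with hS
  obtain ⟨H, hH, -⟩ := exists_continuousMap_of_summable (d := d) (c := fun k => (c k : ℂ))
    (by simpa using hcs.abs)
  let g : (Fin d → ℤ) → ℂ := fun k => (if k = 0 then (S : ℂ) else 0) - c k
  have hgs : Summable fun k => ‖g k‖ := by
    refine Summable.norm (Summable.sub ?_ ?_)
    · exact (hasSum_ite_eq (0 : Fin d → ℤ) (S : ℂ)).summable
    · exact Complex.hasSum_ofReal.mpr hcs.hasSum |>.summable
  obtain ⟨F, hF, hFc⟩ := exists_continuousMap_of_summable hgs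
  have hFH : ∀ x, F x = S - H x := by
    intro x
    refine (hF x).unique ?_
    have h1 : HasSum (fun k => (if k = 0 then (S : ℂ) else 0) * mFourier k x) S := by
      convert hasSum_single (f := fun k => (if k = 0 then (S : ℂ) else 0) * mFourier k x) 0 ?_
        using 1
      · simp [mFourier_zero]
      · intro k hk; simp [hk]
    simpa only [g, sub_mul] using h1.sub (hH x)
  have hHreal : ∀ x, ((H x).re : ℂ) = H x := by
    intro x
    rw [← Complex.conj_eq_iff_re]
    have h1 := (Equiv.neg (Fin d → ℤ)).hasSum_iff.mpr (hH x)
    have h2 : HasSum (fun k => star ((c k : ℂ) * mFourier k x)) (star (H x)) := (hH x).star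
    refine (h2.unique ?_)
    refine h1.congr_fun fun k => ?_
    simp only [Function.comp_apply, Equiv.neg_apply, c, norm_neg, mFourier_neg, star_mul']
    congr 1
    exact Complex.conj_ofReal _
  have hHre : ∀ x, HasSum (fun k => c k * (mFourier k x).re) (H x).re := by
    intro x
    have := Complex.hasSum_re (hH x)
    simpa using this
  have hwF : (fun x => ((S - (H x).re : ℝ) : ℂ)) = F := by
    ext x
    rw [hFH, Complex.ofReal_sub, hHreal]
  refine ⟨fun x => S - (H x).re, by fun_prop, ?_, ?_, (1 / 2) * (1 / 2) ^ α, by positivity,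
    fun x => ?_⟩
  · have h1 := hHre 0
    have h2 : (fun k => c k * (mFourier k (0 : Torus d)).re) = c := by
      ext k
      have : mFourier k (0 : Torus d) = 1 := by simp [mFourier]
      rw [this]; simp
    rw [h2] at h1
    simp only [hS, h1.tsum_eq, sub_self]
  · rw [hwF]
    refine ⟨memLp_continuousMap F 2, ?_⟩
    have hsum := (summable_norm_rpow_neg (d := d) (t := 2 * (d + α) - 2 * s) (by linarith)).mul_left
      ((d : ℝ) ^ s)
    refine hsum.of_nonneg_of_le (fun k => by positivity) fun k => ?_
    rw [hFc]
    by_cases hk : k = 0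
    · subst hk
      simp only [Pi.zero_apply, Int.cast_zero, ne_eq, OfNat.ofNat_ne_zero, not_false_eq_true,
        zero_pow, Finset.sum_const_zero, Real.zero_rpow hs.ne', zero_mul]
      positivity
    · have hk1 := one_le_norm_of_ne_zero hk
      have hk0 : 0 < ‖k‖ := by linarith
      have h1 : ‖g k‖ = ‖k‖ ^ (-(d + α)) := by
        simp only [g, if_neg hk, zero_sub, norm_neg, Complex.norm_real]
        exact Real.norm_of_nonneg (hc0 k)
      rw [h1]
      calc (∑ i, (k i : ℝ) ^ 2) ^ s * (‖k‖ ^ (-(d + α))) ^ 2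
          ≤ (d * ‖k‖ ^ 2) ^ s * (‖k‖ ^ (-(d + α))) ^ 2 := by
            gcongr
            exact sum_sq_le_mul_sq_norm k
        _ = _ := by
            rw [Real.mul_rpow hd (by positivity), mul_assoc, ← Real.rpow_natCast,
              ← Real.rpow_natCast, ← Real.rpow_mul hk0.le, ← Real.rpow_mul hk0.le,
              ← Real.rpow_add hk0]
            congr 2; push_cast; ring
  · by_cases hx : x = 0
    · subst hx
      rw [norm_zero, Real.zero_rpow hα0.ne', mul_zero]
      have := hasSum_le (fun k => ?_) (hHre 0) hcs.hasSum
      · simpa [hS] using this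
      · calc c k * (mFourier k (0 : Torus d)).re ≤ c k * 1 := by
              gcongr
              exact (Complex.re_le_norm _).trans (norm_mFourier_apply k _).le
          _ = c k := mul_one _
    have hx0 : 0 < ‖x‖ := norm_pos_iff.mpr hx
    -- Keep only the frequencies in a box of side `N ≈ 1/‖x‖`: weights at least `N^(-(d+α))` against
    -- a sum of at least `N^d / 2` give `N^(-α) / 2`, comparable to `‖x‖^α`.
    set N := ⌈‖x‖⁻¹⌉₊ with hN
    have hN1 : ‖x‖⁻¹ ≤ N := Nat.le_ceil _
    have hxi : 2 ≤ ‖x‖⁻¹ := by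
      rw [le_inv_comm₀ (by norm_num) hx0]
      simpa using norm_torus_le x
    have hN2 : (N : ℝ) ≤ 2 * ‖x‖⁻¹ := by
      have := Nat.ceil_lt_add_one (by positivity : 0 ≤ ‖x‖⁻¹)
      rw [← hN] at this; linarith
    have hN0 : (0 : ℝ) < N := by linarith
    have hre : ∀ k, 0 ≤ 1 - (mFourier k x).re := fun k => by
      have := (Complex.re_le_norm (mFourier k x)).trans (norm_mFourier_apply k _).le
      linarith
    have hsum : HasSum (fun k => c k * (1 - (mFourier k x).re)) (S - (H x).re) := by
      simpa only [mul_sub, mul_one] using hcs.hasSum.sub (hHre x)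
    have h1 := sum_le_hasSum (latticeBox d N) (fun k _ => mul_nonneg (hc0 k) (hre k)) hsum
    refine le_trans ?_ h1
    have h2 : (N : ℝ) ^ (-(d + α)) * ∑ k ∈ latticeBox d N, (1 - (mFourier k x).re)
        ≤ ∑ k ∈ latticeBox d N, c k * (1 - (mFourier k x).re) := by
      rw [Finset.mul_sum]
      refine Finset.sum_le_sum fun k hk => ?_
      by_cases hk0 : k = 0
      · subst hk0; simp [mFourier_zero]
      · have := hre k
        gcongr
        have hk1 := one_le_norm_of_ne_zero hk0
        exact Real.rpow_le_rpow_of_nonpos (by linarith) (norm_le_of_mem_latticeBox hk)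
          (by linarith)
    refine le_trans ?_ h2
    have h3 : (N : ℝ) ^ d / 2 ≤ ∑ k ∈ latticeBox d N, (1 - (mFourier k x).re) := by
      rw [Finset.sum_sub_distrib, Finset.sum_const, card_latticeBox, ← Complex.re_sum]
      have := (Complex.re_le_norm _).trans (norm_sum_latticeBox_le hx hN1)
      simp only [nsmul_eq_mul, Nat.cast_pow, mul_one]
      linarith
    have h4 : (N : ℝ) ^ (-(d + α)) * ((N : ℝ) ^ d / 2) = 1 / 2 * (N : ℝ) ^ (-α) := by
      have : (N : ℝ) ^ (-(d + α)) * (N : ℝ) ^ d = (N : ℝ) ^ (-α) := by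
        rw [← Real.rpow_natCast, ← Real.rpow_add hN0]; congr 1; ring
      rw [← this]; ring
    calc 1 / 2 * (1 / 2) ^ α * ‖x‖ ^ α = 1 / 2 * (2 * ‖x‖⁻¹) ^ (-α) := by
          rw [mul_assoc, ← Real.mul_rpow (by norm_num) hx0.le, Real.rpow_neg (by positivity),
            ← Real.inv_rpow (by positivity)]
          congr 2; field_simp
      _ ≤ 1 / 2 * (N : ℝ) ^ (-α) := by
          gcongr 1 / 2 * ?_
          exact Real.rpow_le_rpow_of_nonpos hN0 hN2 (by linarith)
      _ = (N : ℝ) ^ (-(d + α)) * ((N : ℝ) ^ d / 2) := h4.symm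
      _ ≤ _ := by gcongr

/-! ### Integrable powers of the norm, and the counterexample. -/

lemma integrable_norm_rpow_unitAddCircle {γ : ℝ} (hγ : γ < 1) :
    Integrable (fun z : UnitAddCircle => ‖z‖ ^ (-γ)) AddCircle.haarAddCircle := by
  rw [haarAddCircle_eq_volume,
    ← (AddCircle.measurePreserving_mk (1 : ℝ) (-(1 / 2))).integrable_comp
      (by fun_prop : Measurable fun z : UnitAddCircle => ‖z‖ ^ (-γ)).aestronglyMeasurable]
  have h1 : IntervalIntegrable (fun t : ℝ => |t| ^ (-γ)) volume 0 (1 / 2) := by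
    refine (intervalIntegral.intervalIntegrable_rpow' (by linarith : -1 < -γ)).congr ?_
    intro t ht
    rw [Set.uIoc_of_le (by norm_num)] at ht
    simp only
    rw [abs_of_pos ht.1]
  have h2 : IntervalIntegrable (fun t : ℝ => |t| ^ (-γ)) volume (-(1 / 2)) 0 := by
    rw [IntervalIntegrable.iff_comp_neg]
    simpa using h1.symm
  have h3 := h2.trans h1
  rw [intervalIntegrable_iff_integrableOn_Ioc_of_le (by norm_num)] at h3
  rw [show -(1 / 2 : ℝ) + 1 = 1 / 2 by norm_num]
  refine h3.congr_fun (fun t ht => ?_) measurableSet_Ioc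
  simp only [Function.comp_apply]
  rw [(AddCircle.norm_coe_eq_abs_iff (1 : ℝ) one_ne_zero).mpr]
  rw [abs_le]; simp only [abs_one]
  exact ⟨ht.1.le, ht.2⟩

instance nullSingletonClass_haarAddCircle :
    NullSingletonClass (AddCircle.haarAddCircle : Measure UnitAddCircle) where
  measure_singleton x := by
    rw [haarAddCircle_eq_volume, ← Metric.closedBall_zero, AddCircle.volume_closedBall]
    simp

/-- Since `‖x i‖ ≤ ‖x‖`, the function is dominated by `∏ ‖x i‖^(-t/d)`, a product of one-dimensional
functions integrable because `t / d < 1`. -/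
lemma integrable_norm_rpow_torus {d : ℕ} (hd : 0 < d) {t : ℝ} (ht0 : 0 ≤ t) (ht : t < d) :
    Integrable (fun x : Torus d => ‖x‖ ^ (-t)) (torusMeasure d) := by
  have hd' : (0 : ℝ) < d := by exact_mod_cast hd
  have h1 : Integrable (fun x : Torus d => ∏ i, ‖x i‖ ^ (-(t / d))) (torusMeasure d) :=
    Integrable.fintype_prod (f := fun _ (z : UnitAddCircle) => ‖z‖ ^ (-(t / d)))
      fun _ => integrable_norm_rpow_unitAddCircle (by rwa [div_lt_one hd'])
  refine h1.mono' (by fun_prop : Measurable fun x : Torus d => ‖x‖ ^ (-t)).aestronglyMeasurable ?_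
  -- Coordinate hyperplanes are discarded, since there a factor `0 ^ (-(t/d))` takes the default
  -- value `0` when `t > 0`.
  have h2 : ∀ᵐ x ∂torusMeasure d, ∀ i, x i ≠ 0 :=
    ae_all_iff.mpr fun i => Measure.ae_eval_ne (μ := fun _ : Fin d => AddCircle.haarAddCircle) i 0
  filter_upwards [h2] with x hx
  rw [Real.norm_of_nonneg (by positivity)]
  have hxi : ∀ i, 0 < ‖x i‖ := fun i => norm_pos_iff.mpr (hx i)
  have hx0 : 0 < ‖x‖ := (hxi ⟨0, hd⟩).trans_le (norm_le_pi_norm x _)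
  calc ‖x‖ ^ (-t) = ∏ _i : Fin d, ‖x‖ ^ (-(t / d)) := by
        rw [Finset.prod_const, Finset.card_univ, Fintype.card_fin, ← Real.rpow_mul_natCast hx0.le]
        congr 1; field_simp
    _ ≤ _ := Finset.prod_le_prod (fun _ _ => by positivity) fun i _ =>
        Real.rpow_le_rpow_of_nonpos (hxi i) (norm_le_pi_norm x i)
          (neg_nonpos.mpr (div_nonneg ht0 hd'.le))

lemma eigenvalueDesc_smul_one {K : ℕ} (t : ℝ) (k : Fin K) :
    eigenvalueDesc ((t : ℂ) • (1 : Matrix (Fin K) (Fin K) ℂ)) k = t := by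
  have hA : ((t : ℂ) • (1 : Matrix (Fin K) (Fin K) ℂ)).IsHermitian := by
    rw [Matrix.IsHermitian, Matrix.conjTranspose_smul, Matrix.conjTranspose_one]
    simp
  obtain ⟨v, hv, hvk⟩ := exists_mulVec_eq_eigenvalueDesc hA k
  rw [Matrix.smul_mulVec, Matrix.one_mulVec] at hvk
  exact_mod_cast (smul_left_injective ℂ hv hvk).symm

lemma memSobolev_zero {d : ℕ} (s : ℝ) : MemSobolev s (fun _ : Torus d => (0 : ℂ)) := by
  refine ⟨MemLp.zero, ?_⟩
  have : ∀ n : Fin d → ℤ, mFourierCoeff (fun _ : Torus d => (0 : ℂ)) n = 0 := fun n => by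
    rw [mFourierCoeff_eq]; simp
  simp only [this]
  simp

/-- Above the critical exponent there is a scalar counterexample. -/
theorem exists_inverseIsMultiplier (d K : ℕ) (hd : 0 < d) (hK : 1 ≤ K) {s : ℝ} {q : ℝ≥0∞}
    (hs : (d : ℝ) / 2 < s) (hsd : s ≤ d)
    (hq : ENNReal.ofReal d / ENNReal.ofReal (d - s) < q) :
    ∃ W : Torus d → Matrix (Fin K) (Fin K) ℂ,
      HermitianWithSobolevEigenvalues s W ∧ NonnegWithSobolevEntries s W ∧
        HasZero (fun x => (W x).det) ∧ InverseIsMultiplier q W := by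
  have hd' : (0 : ℝ) < d := by exact_mod_cast hd
  have hs0 : 0 < s := by linarith [half_pos hd']
  have hsd' : 0 < d - s := by
    -- For `s = d` the critical exponent is `∞` and no `q` exceeds it.
    rcases hsd.eq_or_lt with h | h
    · rw [h, sub_self, ENNReal.ofReal_zero, ENNReal.div_zero (by simpa using hd.ne')] at hq
      exact absurd hq not_top_lt
    · linarith
  rw [← ENNReal.ofReal_div_of_pos hsd'] at hq
  obtain ⟨Q, hQ, hQq⟩ : ∃ Q : ℝ, d / (d - s) < Q ∧ (q = ⊤ ∨ q = ENNReal.ofReal Q) := by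
    by_cases hqt : q = ⊤
    · exact ⟨d / (d - s) + 1, by linarith, Or.inl hqt⟩
    · refine ⟨q.toReal, ?_, Or.inr (ENNReal.ofReal_toReal hqt).symm⟩
      rw [← ENNReal.ofReal_toReal hqt, ENNReal.ofReal_lt_ofReal_iff'] at hq
      exact hq.1
  have hQ2 : 2 < Q := by
    refine lt_trans ?_ hQ
    rw [lt_div_iff₀ hsd']; linarith
  have hQd : d / Q < d - s := by
    rw [div_lt_iff₀ hsd'] at hQ
    rw [div_lt_iff₀ (by linarith)]; linarith
  -- The gap for `α` is `Q > d/(d-s)` rewritten. The upper bound on `α` opens the gap for `p`: `p <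
  -- d/α` makes `w⁻¹` lie in `L^p`, and `p > 2Q/(Q-2)` means `1/p + 1/Q < 1/2`.
  obtain ⟨α, hα1, hα2⟩ : ∃ α, s - d / 2 < α ∧ α < d / 2 - d / Q := exists_between (by linarith)
  have hα0 : 0 < α := by linarith
  obtain ⟨p, hp1, hp2⟩ : ∃ p, 2 * Q / (Q - 2) < p ∧ p < d / α := by
    refine exists_between ?_
    rw [div_lt_div_iff₀ (by linarith) hα0]
    have : (d / 2 - d / Q) * (2 * Q) = d * (Q - 2) := by field_simp
    nlinarith
  rw [div_lt_iff₀ (by linarith)] at hp1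
  rw [lt_div_iff₀ hα0] at hp2
  have hp : 2 < p := by nlinarith
  have hpQ : 4 < (p - 2) * (Q - 2) := by nlinarith
  obtain ⟨w, hwc, hw0, hws, c, hc, hwl⟩ := exists_memSobolev_ge_rpow d hs0 hα0 hα1
  have hwnn : ∀ x, 0 ≤ w x := fun x => le_trans (by positivity) (hwl x)
  have hne : ∀ᵐ x ∂torusMeasure d, x ≠ 0 := by
    filter_upwards [Measure.ae_eval_ne (μ := fun _ : Fin d => AddCircle.haarAddCircle)
      (⟨0, hd⟩ : Fin d) 0] with x hx h0
    exact hx (by rw [h0]; rfl)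
  have hwpos : ∀ x, x ≠ 0 → 0 < w x := fun x hx => by
    have : 0 < ‖x‖ := norm_pos_iff.mpr hx
    exact lt_of_lt_of_le (by positivity) (hwl x)
  let u : Torus d → ℂ := fun x => ((w x)⁻¹ : ℝ)
  have hum : Measurable u := Complex.measurable_ofReal.comp hwc.measurable.inv
  have hup : MemLp u (ENNReal.ofReal p) (torusMeasure d) := by
    rw [← integrable_norm_rpow_iff hum.aestronglyMeasurable (by simp; linarith)
      ENNReal.ofReal_ne_top, ENNReal.toReal_ofReal (by linarith)]
    have h1 := (integrable_norm_rpow_torus hd (t := α * p) (by positivity)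
      (by linarith)).const_mul (c⁻¹ ^ p)
    refine h1.mono' (by fun_prop : Measurable fun x => ‖u x‖ ^ p).aestronglyMeasurable ?_
    filter_upwards [hne] with x hx
    have hx0 : 0 < ‖x‖ := norm_pos_iff.mpr hx
    have hw := hwpos x hx
    rw [Real.norm_of_nonneg (by positivity)]
    simp only [u]
    rw [Complex.norm_real, Real.norm_of_nonneg (by positivity)]
    calc (w x)⁻¹ ^ p ≤ (c * ‖x‖ ^ α)⁻¹ ^ p := by
          gcongr
          exact hwl x
      _ = c⁻¹ ^ p * ‖x‖ ^ (-(α * p)) := by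
          rw [mul_inv, Real.mul_rpow (by positivity) (by positivity), ← Real.rpow_neg hx0.le,
            ← Real.rpow_mul hx0.le, neg_mul]
  have hu2 : MemLp u 2 (torusMeasure d) := hup.mono_exponent (by
    rw [← ENNReal.ofReal_ofNat]; exact ENNReal.ofReal_le_ofReal hp.le)
  have hscal : IsScalarMultiplier q u := by
    rcases hQq with rfl | rfl
    · exact isScalarMultiplier_top hu2
    · exact isScalarMultiplier_of_memLp hp hQ2 hpQ hum hup
  have hq1 : 1 ≤ q := by
    rcases hQq with rfl | rfl
    · exact le_top
    · rw [← ENNReal.ofReal_one]; exact ENNReal.ofReal_le_ofReal (by linarith)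
  have hentry : ∀ i j : Fin K, MemSobolev s
      fun x => ((w x : ℂ) • (1 : Matrix (Fin K) (Fin K) ℂ)) i j := by
    intro i j
    by_cases hij : i = j
    · subst hij; simpa using hws
    · simpa [hij] using memSobolev_zero s
  have hpsd : ∀ x, ((w x : ℂ) • (1 : Matrix (Fin K) (Fin K) ℂ)).PosSemidef := fun x =>
    Matrix.PosSemidef.one.smul (by exact_mod_cast hwnn x)
  refine ⟨fun x => (w x : ℂ) • 1, ⟨fun i j => ?_, ae_of_all _ fun x => (hpsd x).1, fun k => ?_⟩,
    ⟨ae_of_all _ hpsd, hentry⟩, ?_, fun x => u x • 1, ?_, hscal.isMatrixMultiplier hq1 hu2⟩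
  · exact (hentry i j).1.integrable (by norm_num)
  · simp only [eigenvalueDesc_smul_one]
    exact hws
  · refine ⟨_, ?_, ae_eq_refl _, 0, ?_⟩
    · simp only [Matrix.det_smul, Matrix.det_one]
      fun_prop
    · simp only [Matrix.det_smul, hw0]
      simp [(Nat.one_le_iff_ne_zero.mp hK)]
  · filter_upwards [hne] with x hx
    have hw := hwpos x hx
    rw [smul_mul_smul_comm, mul_one]
    simp only [u]
    rw [← Complex.ofReal_mul, mul_inv_cancel₀ hw.ne']; simp

end SobolevMultiplier

end

open SobolevMultiplier

/-! ### Exponent arithmetic and conclusion. -/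

lemma sub_le_mul_toReal_inv {d : ℕ} {s : ℝ} {q : ℝ≥0∞} (hsd : s ≤ d)
    (hq0 : q ≠ 0) (hq : q ≤ ENNReal.ofReal d / ENNReal.ofReal (d - s)) :
    d - s ≤ d * q⁻¹.toReal := by
  rcases hsd.eq_or_lt with h | h
  · rw [h, sub_self]; positivity
  have h1 : 0 < d - s := by linarith
  rw [← ENNReal.ofReal_div_of_pos h1] at hq
  have hqt : q ≠ ⊤ := ne_top_of_le_ne_top ENNReal.ofReal_ne_top hq
  have hq0' := ENNReal.toReal_pos hq0 hqt
  have h2 := ENNReal.toReal_mono ENNReal.ofReal_ne_top hq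
  rw [ENNReal.toReal_ofReal (by positivity), le_div_iff₀ h1] at h2
  rw [ENNReal.toReal_inv, ← div_eq_mul_inv, le_div_iff₀ hq0']
  linarith

/-- The strict bound on `q` says `d - d/q < d/2 + 1`, which leaves room for `t` below `s`; for `d =
2` it only says that `q` is finite. The term `d/2 + 1/2` keeps `t` above `d/2`. -/
lemma exists_lt_sub_le_mul_toReal_inv {d : ℕ} {s : ℝ} {q : ℝ≥0∞} (hsd : s ≤ d)
    (hs : s = (d : ℝ) / 2 + 1) (hq0 : q ≠ 0)
    (hq : q < ENNReal.ofReal (2 * d) / ENNReal.ofReal (d - 2)) :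
    ∃ t, (d : ℝ) / 2 < t ∧ t < (d : ℝ) / 2 + 1 ∧ t ≤ s ∧ d - t ≤ d * q⁻¹.toReal := by
  have hlt : d - s < d * q⁻¹.toReal := by
    have hqt : q ≠ ⊤ := hq.ne_top
    have hq0' := ENNReal.toReal_pos hq0 hqt
    rw [ENNReal.toReal_inv, ← div_eq_mul_inv, lt_div_iff₀ hq0']
    rcases hsd.eq_or_lt with h | h
    · rw [h, sub_self, zero_mul]; linarith
    have h1 : (0 : ℝ) < d - 2 := by linarith
    rw [← ENNReal.ofReal_div_of_pos h1] at hq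
    have h2 := ENNReal.toReal_strict_mono ENNReal.ofReal_ne_top hq
    rw [ENNReal.toReal_ofReal (by positivity), lt_div_iff₀ h1] at h2
    rw [hs]
    linarith
  refine ⟨max (d / 2 + 1 / 2) (d - d * q⁻¹.toReal), lt_max_of_lt_left (by linarith),
    max_lt (by linarith) (by linarith), max_le (by linarith) (by linarith), ?_⟩
  linarith [le_max_right ((d : ℝ) / 2 + 1 / 2) (d - d * q⁻¹.toReal)]

theorem corollary1p4 (d K : ℕ) (hK : 1 ≤ K) (s : ℝ) (hs : (d : ℝ) / 2 < s) (hsd : s ≤ d) :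
    -- Hermitian matrix functions with eigenvalues in `W^{s,2}`
    ((s < (d : ℝ) / 2 + 1 →
        (∀ W : Torus d → Matrix (Fin K) (Fin K) ℂ,
          HermitianWithSobolevEigenvalues s W → HasZero (fun x => (W x).det) →
          ∀ q : ℝ≥0∞, 2 ≤ q → q ≤ ENNReal.ofReal d / ENNReal.ofReal (d - s) →
            ¬ InverseIsMultiplier q W) ∧
        (∀ q : ℝ≥0∞, ENNReal.ofReal d / ENNReal.ofReal (d - s) < q →
          ∃ W : Torus d → Matrix (Fin K) (Fin K) ℂ,
            HermitianWithSobolevEigenvalues s W ∧ HasZero (fun x => (W x).det) ∧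
            InverseIsMultiplier q W)) ∧
      (s = (d : ℝ) / 2 + 1 →
        ∀ W : Torus d → Matrix (Fin K) (Fin K) ℂ,
          HermitianWithSobolevEigenvalues s W → HasZero (fun x => (W x).det) →
          ∀ q : ℝ≥0∞, 2 ≤ q → q < ENNReal.ofReal (2 * d) / ENNReal.ofReal (d - 2) →
            ¬ InverseIsMultiplier q W)) ∧
    -- nonnegative matrix functions with entries in `W^{s,2}`
    ((s < (d : ℝ) / 2 + 1 →
        (∀ W : Torus d → Matrix (Fin K) (Fin K) ℂ,
          NonnegWithSobolevEntries s W → HasZero (fun x => (W x).det) →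
          ∀ q : ℝ≥0∞, 2 ≤ q → q ≤ ENNReal.ofReal d / ENNReal.ofReal (d - s) →
            ¬ InverseIsMultiplier q W) ∧
        (∀ q : ℝ≥0∞, ENNReal.ofReal d / ENNReal.ofReal (d - s) < q →
          ∃ W : Torus d → Matrix (Fin K) (Fin K) ℂ,
            NonnegWithSobolevEntries s W ∧ HasZero (fun x => (W x).det) ∧
            InverseIsMultiplier q W)) ∧
      (s = (d : ℝ) / 2 + 1 →
        ∀ W : Torus d → Matrix (Fin K) (Fin K) ℂ,
          NonnegWithSobolevEntries s W → HasZero (fun x => (W x).det) →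
          ∀ q : ℝ≥0∞, 2 ≤ q → q < ENNReal.ofReal (2 * d) / ENNReal.ofReal (d - 2) →
            ¬ InverseIsMultiplier q W)) := by
  have hd : 0 < d := by
    rcases Nat.eq_zero_or_pos d with rfl | h
    · simp only [Nat.cast_zero] at hs hsd; linarith
    · exact h
  have hd' : (0 : ℝ) < d := by exact_mod_cast hd
  have hq12 : ∀ {q : ℝ≥0∞}, 2 ≤ q → 1 ≤ q := fun h => le_trans (by norm_num) h
  refine ⟨⟨fun hs1 => ⟨fun W hW hdet q hq hqs => ?_, fun q hq => ?_⟩,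
      fun hs1 W hW hdet q hq hqs => ?_⟩,
    ⟨fun hs1 => ⟨fun W hW hdet q hq hqs => ?_, fun q hq => ?_⟩,
      fun hs1 W hW hdet q hq hqs => ?_⟩⟩
  · exact hW.not_inverseIsMultiplier hd hs hs1 hdet (hq12 hq)
      (sub_le_mul_toReal_inv hsd (zero_lt_one.trans_le (hq12 hq)).ne' hqs)
  · obtain ⟨W, h1, -, h2, h3⟩ := exists_inverseIsMultiplier d K hd hK hs hsd hq
    exact ⟨W, h1, h2, h3⟩
  · obtain ⟨t, h1, h2, h3, h4⟩ := exists_lt_sub_le_mul_toReal_inv hsd hs1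
      (zero_lt_one.trans_le (hq12 hq)).ne' hqs
    have hW' : HermitianWithSobolevEigenvalues t W :=
      ⟨hW.1, hW.2.1, fun k => (hW.2.2 k).mono (by linarith) h3⟩
    exact hW'.not_inverseIsMultiplier hd h1 h2 hdet (hq12 hq) h4
  · exact hW.not_inverseIsMultiplier hd hs hs1 hdet (hq12 hq)
      (sub_le_mul_toReal_inv hsd (zero_lt_one.trans_le (hq12 hq)).ne' hqs)
  · obtain ⟨W, -, h1, h2, h3⟩ := exists_inverseIsMultiplier d K hd hK hs hsd hq
    exact ⟨W, h1, h2, h3⟩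
  · obtain ⟨t, h1, h2, h3, h4⟩ := exists_lt_sub_le_mul_toReal_inv hsd hs1
      (zero_lt_one.trans_le (hq12 hq)).ne' hqs
    have hW' : NonnegWithSobolevEntries t W :=
      ⟨hW.1, fun i j => (hW.2 i j).mono (by linarith) h3⟩
    exact hW'.not_inverseIsMultiplier hd h1 h2 hdet (hq12 hq) h4
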